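/- Let $X$ be a connected graph (not necessarily locally finite). For $C\subseteq VX$ let $NC$ be the set of vertices outside $C$ adjacent to $C$, and $C^*=VX\setminus(C\cup NC)$. A ray is a one-way infinite path. Two rays are equivalent if there is no connected set $C$ with $NC$ finite such that one ray is eventually in $C$ and the other eventually in $C^*$; the classes are the (vertex) ends, and $\Omega$ is the set of ends of $X$. An end lies in a set $A$ if each of its rays is eventually in $A$. A set $C$ separates two ends if one lies in $C$ and the other in $C^*$. Two ends of a graph can be separated by $k$ vertices if there is a set $F$ of $k$ vertices such that they lie in distinct components of the graph minus $F$. Let $\mathcal C$ be the set of all connected $C\subseteq VX$ with $NC$ finite, $(C^*)^*=C$, which separate some two ends and for which $|NC|=\kappa$ is smallest possible among such sets. Call $C,D$ nested if for some $C'\in\{C,C^*\}$, $D'\in\{D,D^*\}$ the corner $C'\cap D'$ contains no element of $\mathcal C$ and $C'\cap ND=D'\cap NC=\emptyset$. Let $\mu(C)$ be the number of $D\in\mathcal C$ not nested with $C$. Let $\mathcal N$ be the set of those $C\in\mathcal C$ for which there are ends $\omega_1,\omega_2$ separated by $C$ such that $\mu(C)\le\mu(D)$ for every $D\in\mathcal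 C$ separating $\omega_1,\omega_2$. The separators are the sets $NC$, $C\in\mathcal N$. A slice is a component of $VX\setminus S$, $S$ a separator, that is not in $\mathcal N$. A set $Y\subseteq VX$ is inseparable if for every $C\in\mathcal N$ exactly one of $Y\subseteq C\cup NC$, $Y\subseteq C^*\cup NC$ holds. A block is a maximal inseparable set that is disjoint from all slices. The structure tree $T=T(\mathcal N)$ has as vertices the separators and the blocks, a separator $S$ and a block $B$ being adjacent iff $S\subseteq B$; the edge $\{S,B\}$ represents the $C\in\mathcal N$ with $NC=S$ and $B\subseteq C\cup NC$. For a block $B$, $X_B$ is the graph on $B$ in which two distinct vertices are adjacent iff they are adjacent in $X$ or lie in a common separator. An end $\omega$ of $X$ corresponds to an end $\varepsilon$ of $T$ if, whenever a ray of $\varepsilon$ passes from a separator $S$ to a block $B$ along an edge, $\omega$ lies in the $C\in\mathcal N$ represented by that edge. An end $\omega$ belongs to a block $B$ if for every $C\in\mathcal N$: $\omega$ lies in $C$ iff $B\subseteq C\cup NC$ (that is, the edges of $T$ containing $\omega$ are those pointing towards $B$). **Theorem.** 1. Each end of $T$ corresponds to exactly one element of $\Omega$, and distinct ends of $T$ correspond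 to distinct elements of $\Omega$. 2. Each end of $X$ that does not correspond to an end of $T$ belongs to a unique block. 3. Let $B$ be a block. Each end $\omega\in\Omega$ belonging to $B$ determines a unique end $\omega^B$ of $X_B$ such that for every ray $R$ of $\omega$ the vertices of $R$ lying in $B$, in their order along $R$, form a ray of $X_B$ belonging to $\omega^B$. If $\omega_1,\omega_2\in\Omega$ belong to $B$, then for every $k\in\mathbb N$ the ends $\omega_1,\omega_2$ can be separated by $k$ vertices in $X$ if and only if $\omega_1^B,\omega_2^B$ can be separated by $k$ vertices in $X_B$. -/

import Mathlib

namespace StructureTree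

universe u

/-! ### Boundaries, rays and vertex ends -/

/-- The boundary `NC`: the vertices outside `C` that are adjacent to a vertex of `C`. -/
def boundary {V : Type u} (G : SimpleGraph V) (C : Set V) : Set V :=
  {v | v ∉ C ∧ ∃ w ∈ C, G.Adj v w}

/-- The `*`-complement `C* = VX \ (C ∪ NC)`. -/
def star {V : Type u} (G : SimpleGraph V) (C : Set V) : Set V :=
  (C ∪ boundary G C)ᶜ

/-- A ray: a one-way infinite path. -/
structure Ray {V : Type u} (G : SimpleGraph V) where
  vert : ℕ → V
  injective : Function.Injective vert
  adj : ∀ n, G.Adj (vert n) (vert (n + 1))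

/-- From some index on, all vertices of the ray lie in `A`. -/
def Ray.EventuallyIn {V : Type u} {G : SimpleGraph V} (R : Ray G) (A : Set V) : Prop :=
  ∃ m, ∀ n, m ≤ n → R.vert n ∈ A

/-- A vertex cut: a connected set of vertices with finite boundary. -/
structure IsVertexCut {V : Type u} (G : SimpleGraph V) (C : Set V) : Prop where
  connected : (G.induce C).Connected
  finite_boundary : (boundary G C).Finite

/-- Two rays are separated by some vertex cut. -/
def Ray.Separated {V : Type u} {G : SimpleGraph V} (R R' : Ray G) : Prop :=
  ∃ C : Set V, IsVertexCut G C ∧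
    ((R.EventuallyIn C ∧ R'.EventuallyIn (star G C)) ∨
      (R'.EventuallyIn C ∧ R.EventuallyIn (star G C)))

theorem Ray.not_eventuallyIn_both {V : Type u} {G : SimpleGraph V} (R : Ray G) (C : Set V)
    (h : R.EventuallyIn C) (h' : R.EventuallyIn (star G C)) : False := by
  obtain ⟨m, hm⟩ := h
  obtain ⟨m', hm'⟩ := h'
  exact hm' (max m m') (le_max_right _ _) (Or.inl (hm (max m m') (le_max_left _ _)))

theorem Ray.eventuallyIn_or {V : Type u} {G : SimpleGraph V} (R : Ray G) (C : Set V)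
    (hC : (boundary G C).Finite) : R.EventuallyIn C ∨ R.EventuallyIn (star G C) := by
  have hfin : (R.vert ⁻¹' boundary G C).Finite := hC.preimage R.injective.injOn
  obtain ⟨b, hb⟩ := hfin.bddAbove
  have hout : ∀ n, b + 1 ≤ n → R.vert n ∉ boundary G C := fun n hn hmem => by
    have := hb hmem
    omega
  by_cases h0 : R.vert (b + 1) ∈ C
  · left
    refine ⟨b + 1, fun n hn => ?_⟩
    induction n, hn using Nat.le_induction with
    | base => exact h0
    | succ n hn ih =>
      by_contra hcon
      exact hout (n + 1) (by omega) ⟨hcon, _, ih, (R.adj n).symm⟩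
  · right
    have key : ∀ n, b + 1 ≤ n → R.vert n ∉ C := fun n hn => by
      induction n, hn using Nat.le_induction with
      | base => exact h0
      | succ n hn ih =>
        intro hcon
        exact hout n hn ⟨ih, _, hcon, R.adj n⟩
    exact ⟨b + 1, fun n hn hmem => hmem.elim (key n hn) (hout n hn)⟩

/-- Two rays are equivalent if no vertex cut separates them. -/
def raySetoid {V : Type u} (G : SimpleGraph V) : Setoid (Ray G) where
  r R R' := ¬ R.Separated R'
  iseqv :=
    { refl := by
        rintro R ⟨C, -, ⟨h, h'⟩ | ⟨h, h'⟩⟩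
        · exact R.not_eventuallyIn_both C h h'
        · exact R.not_eventuallyIn_both C h h'
      symm := by
        rintro R R' h ⟨C, hC, h'⟩
        exact h ⟨C, hC, h'.symm⟩
      trans := by
        rintro R R' R'' h h' ⟨C, hC, ⟨h1, h2⟩ | ⟨h1, h2⟩⟩
        · rcases R'.eventuallyIn_or C hC.finite_boundary with h3 | h3
          · exact h' ⟨C, hC, Or.inl ⟨h3, h2⟩⟩
          · exact h ⟨C, hC, Or.inl ⟨h1, h3⟩⟩
        · rcases R'.eventuallyIn_or C hC.finite_boundary with h3 | h3
          · exact h ⟨C, hC, Or.inr ⟨h3, h2⟩⟩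
          · exact h' ⟨C, hC, Or.inr ⟨h1, h3⟩⟩ }

/-- The vertex ends of a graph: equivalence classes of rays. For a tree these are its usual ends. -/
def VertexEnd {V : Type u} (G : SimpleGraph V) : Type u := Quotient (raySetoid G)

/-- The end of a ray. -/
def Ray.toEnd {V : Type u} {G : SimpleGraph V} (R : Ray G) : VertexEnd G :=
  Quotient.mk (raySetoid G) R

/-- Every ray of the end `ω` lies in `A` from some index on. -/
def VertexEnd.LiesIn {V : Type u} {G : SimpleGraph V} (ω : VertexEnd G) (A : Set V) : Prop :=
  ∀ R : Ray G, R.toEnd = ω → R.EventuallyIn A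

/-- The ends `ω₁`, `ω₂` can be separated by removing `k` vertices: they lie in distinct
components of what is left. -/
def VertexEnd.SeparatedByVertices {V : Type u} {G : SimpleGraph V} (k : ℕ)
    (ω₁ ω₂ : VertexEnd G) : Prop :=
  ∃ F : Finset V, F.card = k ∧ ∃ K₁ K₂ : G.ComponentCompl (F : Set V),
    K₁ ≠ K₂ ∧ ω₁.LiesIn (K₁ : Set V) ∧ ω₂.LiesIn (K₂ : Set V)

/-! ### The cut system of the vertex ends -/

/-- The set `C` separates the ends `ω₁` and `ω₂`. -/
def SeparatesEnds {V : Type u} (G : SimpleGraph V) (C : Set V) (ω₁ ω₂ : VertexEnd G) : Prop :=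
  (ω₁.LiesIn C ∧ ω₂.LiesIn (star G C)) ∨ (ω₂.LiesIn C ∧ ω₁.LiesIn (star G C))

/-- A connected set `C` with finite boundary and `(C*)* = C` that separates two ends. -/
structure IsEndCut {V : Type u} (G : SimpleGraph V) (C : Set V) : Prop where
  isVertexCut : IsVertexCut G C
  star_star : star G (star G C) = C
  separates : ∃ ω₁ ω₂ : VertexEnd G, SeparatesEnds G C ω₁ ω₂

/-- The cut system `𝓒` of the vertex ends: the thin end cuts, that is those whose boundary has
the least possible number `κ` of elements. -/
def endCutSystem {V : Type u} (G : SimpleGraph V) : Set (Set V) :=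
  {C | IsEndCut G C ∧ ∀ D, IsEndCut G D → (boundary G C).ncard ≤ (boundary G D).ncard}

/-- `C` and `D` are nested with respect to the cut system `𝓒`: one of the four corners
`C' ∩ D'`, with `C'` one of `C`, `C*` and `D'` one of `D`, `D*`, contains no cut and has both
of its adjacent links `C' ∩ ND`, `D' ∩ NC` empty. -/
def Nested {V : Type u} (G : SimpleGraph V) (𝓒 : Set (Set V)) (C D : Set V) : Prop :=
  ∃ C' D' : Set V, (C' = C ∨ C' = star G C) ∧ (D' = D ∨ D' = star G D) ∧
    (∀ E ∈ 𝓒, ¬ E ⊆ C' ∩ D') ∧ C' ∩ boundary G D = ∅ ∧ D' ∩ boundary G C = ∅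

/-- `μ(C)`: the number of cuts in `𝓒` that are not nested with `C`. -/
noncomputable def mu {V : Type u} (G : SimpleGraph V) (𝓒 : Set (Set V)) (C : Set V) : ℕ∞ :=
  {D | D ∈ 𝓒 ∧ ¬ Nested G 𝓒 C D}.encard

/-- The nested subsystem `𝓝` of `𝓒`: the cuts that are optimally nested with respect to some
pair of ends, i.e. have the least value of `μ` among the cuts in `𝓒` separating this pair. -/
def nestedSubsystem {V : Type u} (G : SimpleGraph V) : Set (Set V) :=
  {C | C ∈ endCutSystem G ∧ ∃ ω₁ ω₂ : VertexEnd G, SeparatesEnds G C ω₁ ω₂ ∧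
    ∀ D ∈ endCutSystem G, SeparatesEnds G D ω₁ ω₂ →
      mu G (endCutSystem G) C ≤ mu G (endCutSystem G) D}

/-! ### Separators, blocks and the structure tree of a nested system `𝓝` -/

/-- The separators: boundaries of cuts. -/
def separators {V : Type u} (G : SimpleGraph V) (𝓝 : Set (Set V)) : Set (Set V) :=
  boundary G '' 𝓝

/-- A slice: a component of `VX \ S`, for a separator `S`, that is not a cut. -/
def IsSlice {V : Type u} (G : SimpleGraph V) (𝓝 : Set (Set V)) (Q : Set V) : Prop :=
  Q ∉ 𝓝 ∧ ∃ S ∈ separators G 𝓝, ∃ K : G.ComponentCompl S, (K : Set V) = Q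

/-- `Y` is `𝓝`-inseparable: for every cut `C` it is contained in exactly one of `C ∪ NC` and
`C* ∪ NC`. -/
def Inseparable {V : Type u} (G : SimpleGraph V) (𝓝 : Set (Set V)) (Y : Set V) : Prop :=
  ∀ C ∈ 𝓝, Xor (Y ⊆ C ∪ boundary G C) (Y ⊆ star G C ∪ boundary G C)

/-- A block: a maximal `𝓝`-inseparable set that is disjoint from all slices. -/
structure IsBlock {V : Type u} (G : SimpleGraph V) (𝓝 : Set (Set V)) (B : Set V) : Prop where
  maximal : Maximal (Inseparable G 𝓝) B
  disjoint : ∀ Q, IsSlice G 𝓝 Q → Disjoint B Q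

/-- The vertices of the structure tree: separators and blocks. -/
abbrev TreeVertex {V : Type u} (G : SimpleGraph V) (𝓝 : Set (Set V)) : Type u :=
  {S : Set V // S ∈ separators G 𝓝} ⊕ {B : Set V // IsBlock G 𝓝 B}

/-- The structure tree `T(𝓝)`: a separator `S` and a block `B` are adjacent iff `S ⊆ B`. The edge
`{S, B}` stands for the cut `C ∈ 𝓝` with `NC = S` and `B ⊆ C ∪ NC`, and is directed from `S`
to `B`. -/
def structureTree {V : Type u} (G : SimpleGraph V) (𝓝 : Set (Set V)) :
    SimpleGraph (TreeVertex G 𝓝) where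
  Adj x y :=
    (∃ S B, x = Sum.inl S ∧ y = Sum.inr B ∧ S.1 ⊆ B.1) ∨
      (∃ S B, y = Sum.inl S ∧ x = Sum.inr B ∧ S.1 ⊆ B.1)
  symm := ⟨fun _ _ h => h.symm⟩
  loopless := ⟨by
    rintro x (⟨S, B, h, h', -⟩ | ⟨S, B, h, h', -⟩) <;> rw [h] at h' <;> cases h'⟩

/-- The graph `X_B`: the subgraph of `X` induced on `B` together with the ideal edges, which join
any two vertices of `B` that lie in a common separator. -/
def blockGraph {V : Type u} (G : SimpleGraph V) (𝓝 : Set (Set V)) (B : Set V) :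
    SimpleGraph B where
  Adj x y := x ≠ y ∧ (G.Adj x y ∨ ∃ S ∈ separators G 𝓝, (x : V) ∈ S ∧ (y : V) ∈ S)
  symm := ⟨fun _ _ h => ⟨h.1.symm, h.2.imp SimpleGraph.Adj.symm
    (fun ⟨S, hS, hx, hy⟩ => ⟨S, hS, hy, hx⟩)⟩⟩
  loopless := ⟨fun _ h => h.1 rfl⟩

/-! ### How the ends of the graph sit in the structure tree -/

/-- The end `ω` of `X` corresponds to the end `ε` of `T(𝓝)`: whenever a ray of `ε` passes from a
separator `S` to a block `B`, `ω` lies in the cut `C` represented by the edge `{S, B}`. -/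
def CorrespondsToTreeEnd {V : Type u} (G : SimpleGraph V) (𝓝 : Set (Set V))
    (ω : VertexEnd G) (ε : VertexEnd (structureTree G 𝓝)) : Prop :=
  ∀ ρ : Ray (structureTree G 𝓝), ρ.toEnd = ε →
    ∀ n S B, ρ.vert n = Sum.inl S → ρ.vert (n + 1) = Sum.inr B →
      ∀ C ∈ 𝓝, boundary G C = S.1 → B.1 ⊆ C ∪ boundary G C → ω.LiesIn C

/-- The end `ω` belongs to the block `B`: the cuts in which `ω` lies are exactly the edges of
`T(𝓝)` that point towards `B`, i.e. the cuts `C` with `B ⊆ C ∪ NC`. -/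
def BelongsToBlock {V : Type u} (G : SimpleGraph V) (𝓝 : Set (Set V))
    (ω : VertexEnd G) (B : Set V) : Prop :=
  ∀ C ∈ 𝓝, ω.LiesIn C ↔ B ⊆ C ∪ boundary G C

/-- The end `η` of `X_B` is the one determined by the end `ω` of `X`: for every ray of `ω`, the
subsequence of its vertices that lie in `B` is (infinite and) a ray of `η`. -/
def InducesBlockEnd {V : Type u} (G : SimpleGraph V) (𝓝 : Set (Set V)) (B : Set V)
    (ω : VertexEnd G) (η : VertexEnd (blockGraph G 𝓝 B)) : Prop :=
  ∀ R : Ray G, R.toEnd = ω → ∃ R' : Ray (blockGraph G 𝓝 B), R'.toEnd = η ∧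
    ∃ φ : ℕ → ℕ, StrictMono φ ∧ Set.range φ = {n | R.vert n ∈ B} ∧
      ∀ n, (R'.vert n : V) = R.vert (φ n)

end StructureTree

namespace StructureTree

universe u

variable {V : Type u} {G : SimpleGraph V}

/-! ### Boundaries and connected sets -/

/-! Let κ be the least boundary size of a cut separating two ends. A thin separator S distributes
the ends among the components of VX∖S, and each component that contains an end is again a thin cut
with boundary S (`exists_cut_of_end`). Failure of nestedness then depends on boundaries only: it
means that one separator meets every thin cut bounded by the other, a symmetric relation (`Crosses`,
`not_nested_iff`). Two vertices have finitely many tight separators of a given size, without any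
local finiteness (`finite_tightlySeparates`), so μ is finite.

Optimally nested cuts are uncrossed by submodularity. If opposite corners of two thin separators
both contain ends, both corners have boundary size κ (`opposite_corners`); if the separators cross,
the values of μ on the two corners have a strictly smaller sum than the original values
(`ncard_crossed_corners_lt`). Crossing separators bound exactly two thin cuts each, so there are
four corners, and comparing their values contradicts the minimality of μ
(`not_crosses_of_mem_nestedSubsystem`). Hence every separator lies on one side of every other one.
Moreover 𝓝 contains all thin cuts that share a boundary with one of its members
(`mem_nestedSubsystem_of_boundary_eq`).

A ray of T yields a strictly descending sequence of cuts. Only finitely many thin cuts contain a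
given vertex and lie in a given cut, so the sequence leaves every finite set and contains exactly
one end (`existsUnique_end_of_descending`); two rays of T with the same end of X eventually share
cuts. Conversely, an end ω selects one cut at each separator. If some selected cut contains no
minimal selected cut, consecutive selected cuts below it form a ray of T
(`exists_treeEnd_of_no_minimalCut`). Otherwise the common part of the selected sides is the block to
which ω belongs (`exists_block_of_minimalCut`).

If an end belongs to the block B, every vertex outside B is cut off by a separator inside B, so each
component of VX∖B attaches to a single separator. Excursions of a ray outside B thus become ideal
edges, and vertex sets pass between X and X_B without enlarging boundaries. A separation in X is
first uncrossed with separators in B until its whole boundary lies in B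
(`exists_separating_in_block`). -/

theorem disjoint_boundary (A : Set V) : Disjoint A (boundary G A) :=
  Set.disjoint_left.2 fun _ h h' => h'.1 h

theorem mem_or_mem_boundary_of_adj {A : Set V} {v w : V} (hv : v ∈ A) (h : G.Adj v w) :
    w ∈ A ∨ w ∈ boundary G A := by
  by_cases hw : w ∈ A
  · exact Or.inl hw
  · exact Or.inr ⟨hw, v, hv, h.symm⟩

theorem mem_star_iff {A : Set V} {v : V} : v ∈ star G A ↔ v ∉ A ∧ v ∉ boundary G A := by
  simp [star]

theorem boundary_star_subset (A : Set V) : boundary G (star G A) ⊆ boundary G A := by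
  rintro v ⟨hv, w, hw, hvw⟩
  rw [mem_star_iff] at hv hw
  by_contra h
  have hvA : v ∈ A := by tauto
  exact (mem_or_mem_boundary_of_adj hvA hvw).elim hw.1 hw.2

theorem star_anti {A B : Set V} (h : A ⊆ B) : star G B ⊆ star G A := by
  intro v hv
  rw [mem_star_iff] at hv ⊢
  refine ⟨fun h' => hv.1 (h h'), ?_⟩
  rintro ⟨-, w, hw, hvw⟩
  exact hv.2 ⟨hv.1, w, h hw, hvw⟩

theorem disjoint_star (A : Set V) : Disjoint A (star G A) :=
  Set.disjoint_left.2 fun _ h h' => (mem_star_iff.1 h').1 h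

theorem union_boundary_mono {A B : Set V} (h : A ⊆ B) :
    A ∪ boundary G A ⊆ B ∪ boundary G B := by
  rintro v (hv | ⟨-, w, hw, hvw⟩)
  · exact Or.inl (h hv)
  · exact mem_or_mem_boundary_of_adj (h hw) hvw.symm

/-- A connected set that meets `Z` and avoids its boundary lies in `Z`. -/
theorem connected_subset {A Z : Set V} (hA : (G.induce A).Connected) (hne : (A ∩ Z).Nonempty)
    (hd : Disjoint A (boundary G Z)) : A ⊆ Z := by
  obtain ⟨a, ha, haZ⟩ := hne
  intro b hb
  obtain ⟨p⟩ := hA.preconnected ⟨a, ha⟩ ⟨b, hb⟩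
  have key : ∀ (x y : A) (p : (G.induce A).Walk x y), (x : V) ∈ Z → (y : V) ∈ Z := by
    intro x y p
    induction p with
    | nil => exact id
    | @cons x y z h p ih =>
      intro hx
      refine ih ((mem_or_mem_boundary_of_adj hx h).resolve_right ?_)
      exact fun h' => Set.disjoint_left.1 hd y.2 h'
  exact key _ _ p haZ

theorem connected_of_forall_subset {A : Set V} (hne : A.Nonempty)
    (h : ∀ Z : Set V, (A ∩ Z).Nonempty → Disjoint A (boundary G Z) → A ⊆ Z) :
    (G.induce A).Connected := by
  have := hne.to_subtype
  refine ⟨fun x y => ?_⟩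
  have := h {w | ∃ hw : w ∈ A, (G.induce A).Reachable x ⟨w, hw⟩}
    ⟨x, x.2, x.2, SimpleGraph.Reachable.refl _⟩ ?_
  · exact (this y.2).2
  · rw [Set.disjoint_left]
    rintro v hv ⟨hv', w, ⟨hw, hr⟩, hvw⟩
    exact hv' ⟨hv, hr.trans (SimpleGraph.Adj.reachable
      (show (G.induce A).Adj ⟨w, hw⟩ ⟨v, hv⟩ from hvw.symm))⟩

theorem connected_nonempty {A : Set V} (hA : (G.induce A).Connected) : A.Nonempty :=
  Set.nonempty_coe_sort.1 hA.nonempty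

/-- The last conjunct expresses that `K` is maximal: no vertex of `Z` outside `K` is adjacent to
`K`. -/
theorem exists_component {Z : Set V} {v : V} (hv : v ∈ Z) :
    ∃ K ⊆ Z, v ∈ K ∧ (G.induce K).Connected ∧ Disjoint Z (boundary G K) := by
  refine ⟨{w | ∃ hw : w ∈ Z, (G.induce Z).Reachable ⟨v, hv⟩ ⟨w, hw⟩}, fun w hw => hw.1,
    ⟨hv, SimpleGraph.Reachable.refl _⟩, ?_, ?_⟩
  · refine connected_of_forall_subset ⟨v, hv, SimpleGraph.Reachable.refl _⟩ ?_
    rintro Y ⟨a, ⟨ha, har⟩, haY⟩ hd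
    rintro b ⟨hb, hbr⟩
    obtain ⟨p⟩ := har.symm.trans hbr
    have key : ∀ (x y : Z) (p : (G.induce Z).Walk x y), (G.induce Z).Reachable ⟨v, hv⟩ x →
        (x : V) ∈ Y → (y : V) ∈ Y := by
      intro x y p
      induction p with
      | nil => exact fun _ => id
      | @cons x y z h p ih =>
        intro hr hx
        have hy := hr.trans h.reachable
        refine ih hy ((mem_or_mem_boundary_of_adj hx h).resolve_right ?_)
        exact fun h' => Set.disjoint_left.1 hd ⟨y.2, hy⟩ h'
    exact key _ _ p har haY
  · rw [Set.disjoint_left]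
    rintro x hx ⟨hx', w, ⟨hw, hr⟩, hxw⟩
    exact hx' ⟨hx, hr.trans (SimpleGraph.Adj.reachable
      (show (G.induce Z).Adj ⟨w, hw⟩ ⟨x, hx⟩ from hxw.symm))⟩

theorem boundary_component_subset {K Z : Set V} (h : K ⊆ Z) (hd : Disjoint Z (boundary G K)) :
    boundary G K ⊆ boundary G Z := by
  rintro v ⟨hv, w, hw, hvw⟩
  exact ⟨fun hZ => Set.disjoint_left.1 hd hZ ⟨hv, w, hw, hvw⟩, w, h hw, hvw⟩

/-! ### Components of the complement of a set -/

/-- `K` is a component of `VX \ S`. -/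
structure IsComp (G : SimpleGraph V) (S K : Set V) : Prop where
  connected : (G.induce K).Connected
  disjoint : Disjoint K S
  boundary_subset : boundary G K ⊆ S

namespace IsComp

theorem exists_mem {S : Set V} {v : V} (hv : v ∉ S) : ∃ K, IsComp G S K ∧ v ∈ K := by
  obtain ⟨K, hK, hvK, hc, hd⟩ := exists_component (G := G) (Z := Sᶜ) hv
  refine ⟨K, ⟨hc, Set.disjoint_left.2 fun _ hx => hK hx, fun x hx => ?_⟩, hvK⟩
  by_contra h
  exact Set.disjoint_left.1 hd h hx

theorem subset_of_connected {S K A : Set V} (hK : IsComp G S K) (hA : (G.induce A).Connected)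
    (hAS : Disjoint A S) (h : (A ∩ K).Nonempty) : A ⊆ K :=
  connected_subset hA h (hAS.mono_right hK.boundary_subset)

theorem eq_of_inter {S K L : Set V} (hK : IsComp G S K) (hL : IsComp G S L)
    (h : (K ∩ L).Nonempty) : K = L :=
  (hL.subset_of_connected hK.connected hK.disjoint h).antisymm
    (hK.subset_of_connected hL.connected hL.disjoint (by rwa [Set.inter_comm]))

theorem disjoint_of_ne {S K L : Set V} (hK : IsComp G S K) (hL : IsComp G S L)
    (h : K ≠ L) : Disjoint K L := by
  by_contra h'
  exact h (hK.eq_of_inter hL (Set.not_disjoint_iff_nonempty_inter.1 h'))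

theorem subset_star {S K L : Set V} (hK : IsComp G S K) (hL : IsComp G S L)
    (h : K ≠ L) : K ⊆ star G L := fun _ hx => mem_star_iff.2
  ⟨fun hx' => Set.disjoint_left.1 (hK.disjoint_of_ne hL h) hx hx',
    fun hx' => Set.disjoint_left.1 hK.disjoint hx (hL.boundary_subset hx')⟩

theorem of_componentCompl {S : Set V} (K : G.ComponentCompl S) : IsComp G S (K : Set V) := by
  obtain ⟨v, hv, rfl⟩ := K.exists_eq_mk
  have hb : boundary G (G.componentComplMk hv : Set V) ⊆ S := by
    rintro x ⟨hx, w, hw, hxw⟩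
    by_contra hxS
    exact hx (SimpleGraph.ComponentCompl.mem_of_adj w x hw hxS hxw.symm)
  have hd : Disjoint (G.componentComplMk hv : Set V) S :=
    (SimpleGraph.ComponentCompl.disjoint_right _).symm
  refine ⟨?_, hd, hb⟩
  obtain ⟨L, hL, hvL⟩ := exists_mem (G := G) hv
  have hLK : L ⊆ (G.componentComplMk hv : Set V) :=
    connected_subset hL.connected ⟨v, hvL, G.componentComplMk_mem hv⟩ (hL.disjoint.mono_right hb)
  have : (G.componentComplMk hv : Set V) = L := by
    refine Set.Subset.antisymm ?_ hLK
    rintro x ⟨hx, hxe⟩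
    obtain ⟨p⟩ := SimpleGraph.ConnectedComponent.exact hxe
    have key : ∀ (x y : (Sᶜ : Set V)) (p : (G.induce Sᶜ).Walk x y), (y : V) ∈ L → (x : V) ∈ L := by
      intro x y p
      induction p with
      | nil => exact id
      | @cons x y z h p ih =>
        intro hx
        refine (mem_or_mem_boundary_of_adj (ih hx) h.symm).resolve_right ?_
        exact fun h' => x.2 (hL.boundary_subset h')
    exact key _ _ p hvL
  rw [this]; exact hL.connected

theorem exists_componentCompl {S K : Set V} (hK : IsComp G S K) :
    ∃ K' : G.ComponentCompl S, (K' : Set V) = K := by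
  obtain ⟨v, hv⟩ := connected_nonempty hK.connected
  have hvS := Set.disjoint_left.1 hK.disjoint hv
  exact ⟨G.componentComplMk hvS, (of_componentCompl _).eq_of_inter hK
    ⟨v, G.componentComplMk_mem hvS, hv⟩⟩

theorem self {A : Set V} (hA : (G.induce A).Connected) : IsComp G (boundary G A) A :=
  ⟨hA, disjoint_boundary A, subset_rfl⟩

end IsComp

/-! ### Ends and sets with finite boundary -/

namespace Ray

theorem EventuallyIn.mono {R : Ray G} {A B : Set V} (h : R.EventuallyIn A) (hAB : A ⊆ B) :
    R.EventuallyIn B := h.imp fun _ h n hn => hAB (h n hn)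

theorem EventuallyIn.inter {R : Ray G} {A B : Set V} (h : R.EventuallyIn A)
    (h' : R.EventuallyIn B) : R.EventuallyIn (A ∩ B) := by
  obtain ⟨m, hm⟩ := h
  obtain ⟨m', hm'⟩ := h'
  exact ⟨max m m', fun n hn => ⟨hm n (le_trans (le_max_left _ _) hn),
    hm' n (le_trans (le_max_right _ _) hn)⟩⟩

theorem EventuallyIn.nonempty {R : Ray G} {A : Set V} (h : R.EventuallyIn A) : A.Nonempty :=
  h.elim fun m hm => ⟨_, hm m le_rfl⟩

theorem eventually_notMem (R : Ray G) {S : Set V} (hS : S.Finite) : R.EventuallyIn Sᶜ := by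
  obtain ⟨b, hb⟩ := (hS.preimage R.injective.injOn).bddAbove
  exact ⟨b + 1, fun n hn hmem => by have := hb hmem; omega⟩

theorem EventuallyIn.exists_component {R : Ray G} {Z : Set V} (h : R.EventuallyIn Z) :
    ∃ K ⊆ Z, (G.induce K).Connected ∧ Disjoint Z (boundary G K) ∧ R.EventuallyIn K := by
  obtain ⟨m, hm⟩ := h
  obtain ⟨K, hK, hvK, hc, hd⟩ := StructureTree.exists_component (G := G) (hm m le_rfl)
  refine ⟨K, hK, hc, hd, m, fun n hn => ?_⟩
  induction n, hn using Nat.le_induction with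
  | base => exact hvK
  | succ n hn ih =>
    exact (mem_or_mem_boundary_of_adj ih (R.adj n)).resolve_right
      (Set.disjoint_left.1 hd (hm _ (by omega)))

/-- A ray that stays in `Z` stays in one component of `Z`, whose boundary is no larger. Thus the
connectedness demanded of a vertex cut may be ignored when ends are separated. -/
theorem separated_of_finite_boundary {R R' : Ray G} {Z : Set V} (hZ : (boundary G Z).Finite)
    (h : R.EventuallyIn Z) (h' : R'.EventuallyIn (star G Z)) : R.Separated R' := by
  obtain ⟨K, hK, hc, hd, hR⟩ := h.exists_component
  exact ⟨K, ⟨hc, hZ.subset (boundary_component_subset hK hd)⟩,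
    Or.inl ⟨hR, h'.mono (star_anti hK)⟩⟩

theorem toEnd_eq_iff {R R' : Ray G} : R.toEnd = R'.toEnd ↔ ¬ R.Separated R' :=
  ⟨fun h => Quotient.exact h, fun h => Quotient.sound h⟩

end Ray

namespace VertexEnd

theorem exists_ray (ω : VertexEnd G) : ∃ R : Ray G, R.toEnd = ω := Quotient.exists_rep ω

theorem LiesIn.mono {ω : VertexEnd G} {A B : Set V} (h : ω.LiesIn A) (hAB : A ⊆ B) :
    ω.LiesIn B := fun R hR => (h R hR).mono hAB

theorem LiesIn.inter {ω : VertexEnd G} {A B : Set V} (h : ω.LiesIn A) (h' : ω.LiesIn B) :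
    ω.LiesIn (A ∩ B) := fun R hR => (h R hR).inter (h' R hR)

theorem LiesIn.nonempty {ω : VertexEnd G} {A : Set V} (h : ω.LiesIn A) : A.Nonempty := by
  obtain ⟨R, hR⟩ := ω.exists_ray
  exact (h R hR).nonempty

theorem liesIn_compl_of_finite (ω : VertexEnd G) {S : Set V} (hS : S.Finite) : ω.LiesIn Sᶜ :=
  fun R _ => R.eventually_notMem hS

theorem liesIn_of_ray {R : Ray G} {A : Set V} (hA : (boundary G A).Finite)
    (h : R.EventuallyIn A) : R.toEnd.LiesIn A := by
  intro R' hR'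
  refine (R'.eventuallyIn_or A hA).resolve_right fun h' => ?_
  exact Ray.toEnd_eq_iff.1 hR'.symm (Ray.separated_of_finite_boundary hA h h')

theorem finite_boundary_star {A : Set V} (hA : (boundary G A).Finite) :
    (boundary G (star G A)).Finite := hA.subset (boundary_star_subset A)

theorem liesIn_or_star (ω : VertexEnd G) {A : Set V} (hA : (boundary G A).Finite) :
    ω.LiesIn A ∨ ω.LiesIn (star G A) := by
  obtain ⟨R, rfl⟩ := ω.exists_ray
  exact (R.eventuallyIn_or A hA).imp (liesIn_of_ray hA) (liesIn_of_ray (finite_boundary_star hA))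

theorem LiesIn.not_disjoint {ω : VertexEnd G} {A B : Set V} (h : ω.LiesIn A) (h' : ω.LiesIn B) :
    ¬ Disjoint A B := Set.not_disjoint_iff_nonempty_inter.2 (h.inter h').nonempty

theorem LiesIn.not_star {ω : VertexEnd G} {A : Set V} (h : ω.LiesIn A) :
    ¬ ω.LiesIn (star G A) := fun h' => h.not_disjoint h' (disjoint_star A)

theorem LiesIn.exists_component {ω : VertexEnd G} {Z : Set V} (hZ : (boundary G Z).Finite)
    (h : ω.LiesIn Z) :
    ∃ K ⊆ Z, (G.induce K).Connected ∧ Disjoint Z (boundary G K) ∧ ω.LiesIn K := by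
  obtain ⟨R, rfl⟩ := ω.exists_ray
  obtain ⟨K, hK, hc, hd, hR⟩ := (h R rfl).exists_component
  exact ⟨K, hK, hc, hd, liesIn_of_ray (hZ.subset (boundary_component_subset hK hd)) hR⟩

theorem exists_comp (ω : VertexEnd G) {S : Set V} (hS : S.Finite) :
    ∃ K, IsComp G S K ∧ ω.LiesIn K := by
  have hb : boundary G Sᶜ ⊆ S := fun x hx => not_not.1 hx.1
  obtain ⟨K, hK, hc, hd, h⟩ := (ω.liesIn_compl_of_finite hS).exists_component (hS.subset hb)
  refine ⟨K, ⟨hc, Set.disjoint_left.2 fun _ hx => hK hx, fun x hx => ?_⟩, h⟩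
  by_contra h'
  exact Set.disjoint_left.1 hd h' hx

theorem exists_separating {ω ω' : VertexEnd G} (h : ω ≠ ω') :
    ∃ Z : Set V, (boundary G Z).Finite ∧ ω.LiesIn Z ∧ ω'.LiesIn (star G Z) := by
  obtain ⟨R, rfl⟩ := ω.exists_ray
  obtain ⟨R', rfl⟩ := ω'.exists_ray
  rw [Ne, Ray.toEnd_eq_iff, not_not] at h
  obtain ⟨C, hC, ⟨h1, h2⟩ | ⟨h1, h2⟩⟩ := h
  · exact ⟨C, hC.2, liesIn_of_ray hC.2 h1, liesIn_of_ray (finite_boundary_star hC.2) h2⟩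
  -- With the roles of the ends exchanged, `C*` is the separating set. Only the inclusion `C ⊆ C**`
  -- is needed, which holds for every set.
  · refine ⟨star G C, finite_boundary_star hC.2, liesIn_of_ray (finite_boundary_star hC.2) h2, ?_⟩
    refine liesIn_of_ray (finite_boundary_star (finite_boundary_star hC.2)) (h1.mono ?_)
    intro x hx
    refine mem_star_iff.2 ⟨fun h => Set.disjoint_left.1 (disjoint_star C) hx h, fun h => ?_⟩
    exact (boundary_star_subset C h).1 hx

end VertexEnd

/-! ### Thin end cuts -/

theorem boundary_star_eq {Y : Set V} (h : ∀ v ∈ boundary G Y, ∃ w ∈ star G Y, G.Adj v w) :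
    boundary G (star G Y) = boundary G Y :=
  (boundary_star_subset Y).antisymm fun v hv =>
    ⟨fun h' => (mem_star_iff.1 h').2 hv, h v hv⟩

theorem star_star_of_boundary_star_eq {Y : Set V} (h : boundary G (star G Y) = boundary G Y) :
    star G (star G Y) = Y := by
  ext x
  rw [mem_star_iff, h, mem_star_iff]
  exact ⟨fun hx => by tauto, fun hx => ⟨fun h => h.1 hx, fun h => h.1 hx⟩⟩

/-- Pass to the component of `Z` containing the first end, then to the component `Y` of its star
containing the second. Each boundary vertex of `Y` has a neighbour in the former component, which
lies in `Y*`, and this gives `Y** = Y`. -/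
theorem exists_isEndCut {Z : Set V} (hZ : (boundary G Z).Finite) {ω₁ ω₂ : VertexEnd G}
    (h₁ : ω₁.LiesIn Z) (h₂ : ω₂.LiesIn (star G Z)) :
    ∃ Y, IsEndCut G Y ∧ boundary G Y ⊆ boundary G Z := by
  obtain ⟨Z₁, hZ₁, -, hd₁, h₁⟩ := h₁.exists_component hZ
  have hb₁ := boundary_component_subset hZ₁ hd₁
  obtain ⟨Y, hY, hYc, hd, h₂⟩ :=
    (h₂.mono (star_anti hZ₁)).exists_component (VertexEnd.finite_boundary_star (hZ.subset hb₁))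
  have hb := (boundary_component_subset hY hd).trans (boundary_star_subset _)
  have hZY : Z₁ ⊆ star G Y := fun x hx => mem_star_iff.2
    ⟨fun h => (mem_star_iff.1 (hY h)).1 hx, fun h => (hb h).1 hx⟩
  refine ⟨Y, ⟨⟨hYc, hZ.subset (hb.trans hb₁)⟩, star_star_of_boundary_star_eq
    (boundary_star_eq ?_), ω₂, ω₁, Or.inl ⟨h₂, h₁.mono hZY⟩⟩, hb.trans hb₁⟩
  intro v hv
  obtain ⟨-, w, hw, hvw⟩ := hb hv
  exact ⟨w, hZY hw, hvw⟩

section cuts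

variable {C D E : Set V}

theorem cut_connected (hC : C ∈ endCutSystem G) : (G.induce C).Connected :=
  hC.1.isVertexCut.connected

theorem cut_finite (hC : C ∈ endCutSystem G) : (boundary G C).Finite :=
  hC.1.isVertexCut.finite_boundary

theorem cut_nonempty (hC : C ∈ endCutSystem G) : C.Nonempty :=
  connected_nonempty (cut_connected hC)

theorem cut_isComp (hC : C ∈ endCutSystem G) : IsComp G (boundary G C) C :=
  IsComp.self (cut_connected hC)

theorem cut_isComp' (hC : C ∈ endCutSystem G) {S : Set V} (h : boundary G C = S) :
    IsComp G S C := h ▸ cut_isComp hC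

theorem ncard_cut_eq (hC : C ∈ endCutSystem G) (hD : D ∈ endCutSystem G) :
    (boundary G C).ncard = (boundary G D).ncard :=
  (hC.2 D hD.1).antisymm (hD.2 C hC.1)

theorem boundary_eq_of_subset (hC : C ∈ endCutSystem G) (hD : D ∈ endCutSystem G)
    (h : boundary G C ⊆ boundary G D) : boundary G C = boundary G D :=
  Set.eq_of_subset_of_ncard_le h (ncard_cut_eq hD hC).le (cut_finite hD)

theorem cut_exists_ends (hC : C ∈ endCutSystem G) :
    ∃ ω₁ ω₂ : VertexEnd G, ω₁.LiesIn C ∧ ω₂.LiesIn (star G C) := by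
  obtain ⟨ω₁, ω₂, h | h⟩ := hC.1.separates
  · exact ⟨ω₁, ω₂, h⟩
  · exact ⟨ω₂, ω₁, h⟩

/-- The least boundary size bounds the boundary of every set separating two ends. -/
theorem ncard_cut_le (hC : C ∈ endCutSystem G) {Z : Set V} (hZ : (boundary G Z).Finite)
    {ω₁ ω₂ : VertexEnd G} (h₁ : ω₁.LiesIn Z) (h₂ : ω₂.LiesIn (star G Z)) :
    (boundary G C).ncard ≤ (boundary G Z).ncard := by
  obtain ⟨Y, hY, hYZ⟩ := exists_isEndCut hZ h₁ h₂
  exact (hC.2 Y hY).trans (Set.ncard_le_ncard hYZ hZ)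

/-- A set of least boundary size that separates two ends contains a thin cut with the same
boundary separating these ends. -/
theorem exists_cut_of_ncard_le (hC : C ∈ endCutSystem G) {Z : Set V}
    (hZ : (boundary G Z).Finite) {ω₁ ω₂ : VertexEnd G} (h₁ : ω₁.LiesIn Z)
    (h₂ : ω₂.LiesIn (star G Z)) (hle : (boundary G Z).ncard ≤ (boundary G C).ncard) :
    ∃ K ∈ endCutSystem G, K ⊆ Z ∧ boundary G K = boundary G Z ∧ ω₁.LiesIn K ∧
      ω₂.LiesIn (star G K) := by
  obtain ⟨K, hK, hKc, hd, h₁⟩ := h₁.exists_component hZ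
  have hb := boundary_component_subset hK hd
  have h₂ := h₂.mono (star_anti hK)
  have hbe : boundary G K = boundary G Z := Set.eq_of_subset_of_ncard_le hb
    (hle.trans (ncard_cut_le hC (hZ.subset hb) h₁ h₂)) hZ
  have hKf : (boundary G K).Finite := hbe ▸ hZ
  obtain ⟨Y, hY, hYc, hYd, hY₂⟩ := h₂.exists_component (VertexEnd.finite_boundary_star hKf)
  have hYb := (boundary_component_subset hY hYd).trans (boundary_star_subset _)
  -- By minimality the component of `K*` around the second end uses the whole boundary. So every
  -- vertex of `NK` has a neighbour in `K*`, whence `K** = K`.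
  have hYbe : boundary G Y = boundary G K := by
    refine Set.eq_of_subset_of_ncard_le hYb ?_ hKf
    rw [hbe]
    refine hle.trans (ncard_cut_le hC (hKf.subset hYb) hY₂ (h₁.mono ?_))
    exact fun x hx => mem_star_iff.2 ⟨fun h => (mem_star_iff.1 (hY h)).1 hx, fun h => (hYb h).1 hx⟩
  refine ⟨K, ⟨⟨⟨hKc, hKf⟩, star_star_of_boundary_star_eq (boundary_star_eq fun v hv => ?_),
    ω₁, ω₂, Or.inl ⟨h₁, h₂⟩⟩, fun D hD => ?_⟩, hK, hbe, h₁, h₂⟩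
  · rw [← hYbe] at hv
    obtain ⟨-, w, hw, hvw⟩ := hv
    exact ⟨w, hY hw, hvw⟩
  · rw [hbe]; exact hle.trans (hC.2 D hD)

/-- A component of the complement of a thin separator that contains an end is a thin cut. -/
theorem IsComp.mem_cuts {K : Set V} (hC : C ∈ endCutSystem G) (hK : IsComp G (boundary G C) K)
    {ω : VertexEnd G} (hω : ω.LiesIn K) :
    K ∈ endCutSystem G ∧ boundary G K = boundary G C := by
  by_cases hKC : K = C
  · exact ⟨hKC ▸ hC, hKC ▸ rfl⟩
  obtain ⟨ω₁, -, h₁, -⟩ := cut_exists_ends hC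
  have hfin := (cut_finite hC).subset hK.boundary_subset
  have h₁ := h₁.mono ((cut_isComp hC).subset_star hK (Ne.symm hKC))
  obtain ⟨L, hL, hLK, hLb, -⟩ := exists_cut_of_ncard_le hC hfin hω h₁
    (Set.ncard_le_ncard hK.boundary_subset (cut_finite hC))
  have : K = L := by
    refine (connected_subset hK.connected ?_ ?_).antisymm hLK
    · rw [Set.inter_eq_right.2 hLK]; exact cut_nonempty hL
    · rw [hLb]; exact disjoint_boundary K
  subst this
  exact ⟨hL, boundary_eq_of_subset hL hC hK.boundary_subset⟩

/-- The selection principle behind everything below: an end picks exactly one thin cut at each thin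
separator, uniqueness being `cut_eq_of_liesIn`. In particular, components without ends may be
disregarded when separators are compared. -/
theorem exists_cut_of_end (hC : C ∈ endCutSystem G) (ω : VertexEnd G) :
    ∃ K ∈ endCutSystem G, boundary G K = boundary G C ∧ ω.LiesIn K := by
  obtain ⟨K, hK, hω⟩ := ω.exists_comp (cut_finite hC)
  exact ⟨K, (hK.mem_cuts hC hω).1, (hK.mem_cuts hC hω).2, hω⟩

theorem cut_eq_of_inter (hC : C ∈ endCutSystem G) (hD : D ∈ endCutSystem G)
    (hb : boundary G C = boundary G D) (h : (C ∩ D).Nonempty) : C = D :=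
  (cut_isComp' hC hb).eq_of_inter (cut_isComp hD) h

theorem cut_eq_of_liesIn (hC : C ∈ endCutSystem G) (hD : D ∈ endCutSystem G)
    (hb : boundary G C = boundary G D) {ω : VertexEnd G} (h : ω.LiesIn C) (h' : ω.LiesIn D) :
    C = D := cut_eq_of_inter hC hD hb (h.inter h').nonempty

theorem cut_disjoint (hC : C ∈ endCutSystem G) (hD : D ∈ endCutSystem G)
    (hb : boundary G C = boundary G D) (h : C ≠ D) : Disjoint C D :=
  (cut_isComp' hC hb).disjoint_of_ne (cut_isComp hD) h

theorem cut_subset_star (hC : C ∈ endCutSystem G) (hD : D ∈ endCutSystem G)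
    (hb : boundary G C = boundary G D) (h : C ≠ D) : C ⊆ star G D :=
  (cut_isComp' hC hb).subset_star (cut_isComp hD) h

theorem exists_other_cut (hC : C ∈ endCutSystem G) :
    ∃ D ∈ endCutSystem G, boundary G D = boundary G C ∧ D ≠ C := by
  obtain ⟨-, ω, -, h⟩ := cut_exists_ends hC
  obtain ⟨D, hD, hb, h'⟩ := exists_cut_of_end hC ω
  exact ⟨D, hD, hb, fun e => (e ▸ h').not_star h⟩

/-! ### Crossing separators -/

/-- The set `S` crosses the thin separator `T`: it meets every thin cut with boundary `T`. -/
def Crosses (G : SimpleGraph V) (S T : Set V) : Prop :=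
  ∀ C ∈ endCutSystem G, boundary G C = T → (C ∩ S).Nonempty

theorem not_crosses_of_disjoint (hC : C ∈ endCutSystem G) {S : Set V} (h : Disjoint C S) :
    ¬ Crosses G S (boundary G C) := fun h' =>
  Set.not_disjoint_iff_nonempty_inter.2 (h' C hC rfl) h

theorem not_crosses_iff {S T : Set V} :
    ¬ Crosses G S T ↔ ∃ C ∈ endCutSystem G, boundary G C = T ∧ Disjoint C S := by
  simp only [Crosses, Set.disjoint_iff_inter_eq_empty, Set.nonempty_iff_ne_empty]
  push Not
  rfl

/-- If the boundary of `C` misses the cut `D`, then `D` lies in a cut with the same boundary as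
`C`. -/
theorem exists_cut_superset (hC : C ∈ endCutSystem G) (hD : D ∈ endCutSystem G)
    (h : Disjoint D (boundary G C)) :
    ∃ L ∈ endCutSystem G, boundary G L = boundary G C ∧ D ⊆ L := by
  obtain ⟨ω, -, hω, -⟩ := cut_exists_ends hD
  obtain ⟨L, hL, hb, hωL⟩ := exists_cut_of_end hC ω
  exact ⟨L, hL, hb, (cut_isComp' hL hb).subset_of_connected (cut_connected hD) h
    (hω.inter hωL).nonempty⟩

/-- Thin separators that do not cross: each lies on one side of the other. -/
theorem exists_cut_boundary_subset (hC : C ∈ endCutSystem G) {S : Set V}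
    (hS : S ∈ boundary G '' endCutSystem G) (h : ¬ Crosses G (boundary G C) S) :
    ∃ L ∈ endCutSystem G, boundary G L = boundary G C ∧ S ⊆ L ∪ boundary G C := by
  obtain ⟨D, hD, rfl, hdis⟩ := not_crosses_iff.1 h
  obtain ⟨L, hL, hb, hDL⟩ := exists_cut_superset hC hD hdis
  exact ⟨L, hL, hb, (Set.subset_union_right.trans (union_boundary_mono hDL)).trans (by rw [hb])⟩

/-- If `ND` misses some cut bounded by `NC`, then `NC` lies on one side of `ND`, and hence misses
any other cut bounded by `ND`. -/
theorem crosses_symm (hC : C ∈ endCutSystem G) (hD : D ∈ endCutSystem G)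
    (h : Crosses G (boundary G C) (boundary G D)) : Crosses G (boundary G D) (boundary G C) := by
  by_contra h'
  obtain ⟨L, hL, hb, hs⟩ := exists_cut_boundary_subset hD ⟨C, hC, rfl⟩ h'
  obtain ⟨L', hL', hb', hne⟩ := exists_other_cut hL
  refine not_crosses_of_disjoint hL' (S := boundary G C) ?_ (by rwa [hb', hb])
  refine Disjoint.mono_right hs (Set.disjoint_union_right.2
    ⟨cut_disjoint hL' hL hb' hne, ?_⟩)
  rw [← hb, ← hb']; exact disjoint_boundary _

/-- Thin separators one of which lies in one side of the other do not cross. -/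
theorem not_crosses_of_subset (hD : D ∈ endCutSystem G) {K S : Set V}
    (hK : IsComp G (boundary G D) K) (h : S ⊆ K ∪ boundary G D) :
    ¬ Crosses G S (boundary G D) := by
  obtain ⟨D', hD', hb, hne⟩ := exists_other_cut hD
  have aux : ∀ L ∈ endCutSystem G, boundary G L = boundary G D → L ≠ K →
      ¬ Crosses G S (boundary G D) := fun L hL hLb hLK h' => by
    obtain ⟨x, hxL, hxS⟩ := h' L hL hLb
    exact (h hxS).elim
      (Set.disjoint_left.1 ((cut_isComp' hL hLb).disjoint_of_ne hK hLK) hxL)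
      (Set.disjoint_left.1 (cut_isComp' hL hLb).disjoint hxL)
  by_cases hDK : D = K
  · exact aux D' hD' hb (hDK ▸ hne)
  · exact aux D hD rfl hDK

theorem not_crosses_of_nested (hC : C ∈ endCutSystem G)
    (h : Nested G (endCutSystem G) C D) : ¬ Crosses G (boundary G D) (boundary G C) := by
  obtain ⟨C', D', hC', -, -, h1, -⟩ := h
  intro hcr
  rcases hC' with rfl | rfl
  · exact (hcr _ hC rfl).ne_empty h1
  · obtain ⟨E, hE, hb, hne⟩ := exists_other_cut hC
    obtain ⟨x, hx, hx'⟩ := hcr E hE hb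
    exact h1.subset ⟨cut_subset_star hE hC hb hne hx, hx'⟩

theorem disjoint_or_star_disjoint (hC : C ∈ endCutSystem G) (hD : D ∈ endCutSystem G)
    (h : ¬ Crosses G (boundary G D) (boundary G C)) :
    C ∩ boundary G D = ∅ ∨ star G C ∩ boundary G D = ∅ := by
  obtain ⟨L, hL, hb, hs⟩ := exists_cut_boundary_subset hC ⟨D, hD, rfl⟩
    (fun h' => h (crosses_symm hC hD h'))
  by_cases hLC : L = C
  · right
    subst hLC
    rw [← Set.disjoint_iff_inter_eq_empty]
    refine Set.disjoint_left.2 fun x hx hx' => ?_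
    rw [mem_star_iff] at hx
    exact (hs hx').elim hx.1 hx.2
  · left
    rw [← Set.disjoint_iff_inter_eq_empty]
    refine Disjoint.mono_right hs (Set.disjoint_union_right.2
      ⟨(cut_disjoint hL hC hb hLC).symm, disjoint_boundary C⟩)

/-- Each separator misses one of the two sides of the other cut, which leaves a corner with empty
links. The boundary of this corner lies in `NC ∩ ND`; a cut inside it would force that intersection
to have κ elements, so `NC = ND`. Equal boundaries are treated separately. -/
theorem nested_of_not_crosses (hC : C ∈ endCutSystem G) (hD : D ∈ endCutSystem G)
    (h : ¬ Crosses G (boundary G D) (boundary G C)) : Nested G (endCutSystem G) C D := by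
  by_cases hb : boundary G C = boundary G D
  · by_cases hCD : C = D
    · subst hCD
      refine ⟨C, star G C, Or.inl rfl, Or.inr rfl, fun E hE hs => ?_, ?_, ?_⟩
      · obtain ⟨x, hx⟩ := cut_nonempty hE
        exact Set.disjoint_left.1 (disjoint_star C) (hs hx).1 (hs hx).2
      · exact Set.disjoint_iff_inter_eq_empty.1 (disjoint_boundary C)
      · exact Set.disjoint_iff_inter_eq_empty.1
          (Set.disjoint_left.2 fun x hx => (mem_star_iff.1 hx).2)
    · refine ⟨C, D, Or.inl rfl, Or.inl rfl, fun E hE hs => ?_, ?_, ?_⟩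
      · obtain ⟨x, hx⟩ := cut_nonempty hE
        exact Set.disjoint_left.1 (cut_disjoint hC hD hb hCD) (hs hx).1 (hs hx).2
      · rw [← hb]; exact Set.disjoint_iff_inter_eq_empty.1 (disjoint_boundary C)
      · rw [hb]; exact Set.disjoint_iff_inter_eq_empty.1 (disjoint_boundary D)
  · obtain ⟨C', hC', hC'D, hC'b, ω₂, hω₂⟩ : ∃ C', (C' = C ∨ C' = star G C) ∧
        C' ∩ boundary G D = ∅ ∧ boundary G C' ⊆ boundary G C ∧
        ∃ ω : VertexEnd G, ω.LiesIn (star G C') := by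
      obtain ⟨ω₁, ω₂, h₁, h₂⟩ := cut_exists_ends hC
      rcases disjoint_or_star_disjoint hC hD h with h | h
      · exact ⟨C, Or.inl rfl, h, subset_rfl, ω₂, h₂⟩
      · exact ⟨_, Or.inr rfl, h, boundary_star_subset C, ω₁, by rwa [hC.1.star_star]⟩
    obtain ⟨D', hD', hD'C, hD'b⟩ : ∃ D', (D' = D ∨ D' = star G D) ∧ D' ∩ boundary G C = ∅ ∧
        boundary G D' ⊆ boundary G D := by
      rcases disjoint_or_star_disjoint hD hC (fun h' => h (crosses_symm hC hD h')) with h | h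
      · exact ⟨D, Or.inl rfl, h, subset_rfl⟩
      · exact ⟨_, Or.inr rfl, h, boundary_star_subset D⟩
    refine ⟨C', D', hC', hD', fun E hE hs => hb ?_, hC'D, hD'C⟩
    have hcap : boundary G (C' ∩ D') ⊆ boundary G C ∩ boundary G D := by
      rintro v ⟨hv, w, hw, hvw⟩
      have h1 : v ∈ C' ∨ v ∈ boundary G C :=
        (mem_or_mem_boundary_of_adj hw.1 hvw.symm).imp_right fun h => hC'b h
      have h2 : v ∈ D' ∨ v ∈ boundary G D :=
        (mem_or_mem_boundary_of_adj hw.2 hvw.symm).imp_right fun h => hD'b h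
      have h3 : ¬ (v ∈ C' ∧ v ∈ boundary G D) := fun h => hC'D.subset h
      have h4 : ¬ (v ∈ D' ∧ v ∈ boundary G C) := fun h => hD'C.subset h
      have h5 : ¬ (v ∈ C' ∧ v ∈ D') := hv
      exact ⟨by tauto, by tauto⟩
    obtain ⟨ω₁, -, h₁, -⟩ := cut_exists_ends hE
    have hle := ncard_cut_le hC ((cut_finite hC).subset (hcap.trans Set.inter_subset_left))
      (h₁.mono hs) (hω₂.mono (star_anti Set.inter_subset_left))
    have heq := Set.eq_of_subset_of_ncard_le (hcap.trans Set.inter_subset_left) hle (cut_finite hC)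
    exact boundary_eq_of_subset hC hD (heq ▸ hcap.trans Set.inter_subset_right)

end cuts

/-! ### Finiteness of the set of tight separators of given size -/

/-- `S` is the boundary of two disjoint connected sets, one of which contains `x` and the
other `y`. -/
def TightlySeparates (G : SimpleGraph V) (S : Set V) (x y : V) : Prop :=
  ∃ A B : Set V, (G.induce A).Connected ∧ (G.induce B).Connected ∧ x ∈ A ∧ y ∈ B ∧
    boundary G A = S ∧ boundary G B = S ∧ Disjoint A B

theorem exists_mem_support_boundary {A : Set V} {x y : V} (p : G.Walk x y) (hx : x ∈ A)
    (hy : y ∉ A) : ∃ v ∈ p.support, v ∈ boundary G A := by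
  induction p with
  | nil => exact absurd hx hy
  | @cons x z y h p ih =>
    rcases mem_or_mem_boundary_of_adj hx h with hz | hz
    · obtain ⟨v, hv, hvA⟩ := ih hz hy
      exact ⟨v, List.mem_cons_of_mem _ hv, hvA⟩
    · exact ⟨z, List.mem_cons_of_mem _ p.start_mem_support, hz⟩

theorem reachable_of_connected {A : Set V} (hA : (G.induce A).Connected) {x y : V}
    (hx : x ∈ A) (hy : y ∈ A) : G.Reachable x y :=
  (hA.preconnected ⟨x, hx⟩ ⟨y, hy⟩).map (SimpleGraph.Embedding.induce A).toHom

theorem boundary_deleteIncidenceSet {p : V} {A : Set V} (hp : p ∉ A) :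
    boundary (G.deleteIncidenceSet p) A = boundary G A \ {p} := by
  ext v
  simp only [boundary, Set.mem_ofPred_eq, SimpleGraph.deleteIncidenceSet_adj, Set.mem_sdiff,
    Set.mem_singleton_iff]
  constructor
  · rintro ⟨h, w, hw, h1, h2, h3⟩
    exact ⟨⟨h, w, hw, h1⟩, h2⟩
  · rintro ⟨⟨h, w, hw, h1⟩, h2⟩
    exact ⟨h, w, hw, h1, h2, fun e => hp (e ▸ hw)⟩

theorem connected_deleteIncidenceSet {p : V} {A : Set V} (hp : p ∉ A)
    (hA : (G.induce A).Connected) :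
    ((G.deleteIncidenceSet p).induce A).Connected := by
  convert hA using 1
  ext v w
  simp only [SimpleGraph.comap_adj, SimpleGraph.deleteIncidenceSet_adj,
    Function.Embedding.subtype_apply]
  exact ⟨fun h => h.1, fun h => ⟨h, fun e => hp (e ▸ v.2), fun e => hp (e ▸ w.2)⟩⟩

/-- Isolating `p` by deleting its edges acts like removing `p` but keeps the vertex type, which
suits the induction on the size of `S`. -/
theorem TightlySeparates.diff {S : Set V} {x y p : V} (h : TightlySeparates G S x y)
    (hp : p ∈ S) : TightlySeparates (G.deleteIncidenceSet p) (S \ {p}) x y := by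
  obtain ⟨A, B, hA, hB, hx, hy, hAS, hBS, hd⟩ := h
  have hpA : p ∉ A := fun h => (hAS ▸ hp : p ∈ boundary G A).1 h
  have hpB : p ∉ B := fun h => (hBS ▸ hp : p ∈ boundary G B).1 h
  exact ⟨A, B, connected_deleteIncidenceSet hpA hA, connected_deleteIncidenceSet hpB hB,
    hx, hy, by rw [boundary_deleteIncidenceSet hpA, hAS],
    by rw [boundary_deleteIncidenceSet hpB, hBS], hd⟩

/-- Two vertices have only finitely many tight separators of a given size. -/
theorem finite_tightlySeparates (k : ℕ) (G : SimpleGraph V) (x y : V) :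
    {S : Set V | S.Finite ∧ S.ncard = k ∧ TightlySeparates G S x y}.Finite := by
  induction k generalizing G with
  | zero =>
    refine (Set.finite_singleton (∅ : Set V)).subset ?_
    rintro S ⟨hS, h, -⟩
    exact (Set.ncard_eq_zero hS).1 h
  | succ k ih =>
    by_cases hr : G.Reachable x y
    · obtain ⟨p⟩ := hr
      -- Every tight separator meets a fixed path from `x` to `y`. For each of its finitely many
      -- vertices `v`, the separators through `v` are counted in the graph with `v` isolated.
      refine ((p.support.finite_toSet).biUnion fun v _ =>
        (ih (G.deleteIncidenceSet v)).image (insert v)).subset ?_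
      rintro S ⟨hS, hk, h⟩
      obtain ⟨v, hv, hvS⟩ : ∃ v ∈ p.support, v ∈ S := by
        obtain ⟨A, B, -, -, hx, hy, rfl, -, hd⟩ := h
        exact exists_mem_support_boundary p hx (Set.disjoint_right.1 hd hy)
      refine Set.mem_biUnion hv ⟨S \ {v}, ⟨hS.sdiff, ?_, h.diff hvS⟩, ?_⟩
      · have := Set.ncard_sdiff_singleton_of_mem hvS
        omega
      · rw [Set.insert_sdiff_singleton, Set.insert_eq_of_mem hvS]
    -- A nonempty tight separator contains a vertex adjacent to both sides, which would connect `x`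
    -- to `y`.
    · refine Set.finite_empty.subset ?_
      rintro S ⟨hS, hk, A, B, hA, hB, hx, hy, hAS, hBS, -⟩
      obtain ⟨s, hs⟩ := Set.nonempty_of_ncard_ne_zero (s := S) (by omega)
      obtain ⟨-, a, ha, hsa⟩ : s ∈ boundary G A := hAS ▸ hs
      obtain ⟨-, b, hb, hsb⟩ : s ∈ boundary G B := hBS ▸ hs
      exact hr ((reachable_of_connected hA hx ha).trans (hsa.symm.reachable.trans
        (hsb.reachable.trans (reachable_of_connected hB hb hy))))

/-- There are only finitely many thin cuts `D` containing `x` such that `y` lies in another cut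
with the same boundary. -/
theorem finite_cuts_separating (x y : V) :
    {D | D ∈ endCutSystem G ∧ x ∈ D ∧ ∃ D' ∈ endCutSystem G, boundary G D' = boundary G D ∧
      D' ≠ D ∧ y ∈ D'}.Finite := by
  rcases Set.eq_empty_or_nonempty (endCutSystem G) with h0 | ⟨C, hC⟩
  · refine Set.finite_empty.subset fun D hD => ?_
    rw [h0] at hD; exact hD.1
  refine Set.Finite.of_finite_image (f := boundary G)
    ((finite_tightlySeparates (boundary G C).ncard G x y).subset ?_) ?_
  · rintro _ ⟨D, ⟨hD, hx, D', hD', hb, hne, hy⟩, rfl⟩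
    exact ⟨cut_finite hD, ncard_cut_eq hD hC, D, D', cut_connected hD, cut_connected hD', hx, hy,
      rfl, hb, (cut_disjoint hD' hD hb hne).symm⟩
  -- Separators have been counted; a cut is recovered from its boundary as the component containing
  -- `x`.
  · rintro D ⟨hD, hx, -⟩ D' ⟨hD', hx', -⟩ hb
    exact cut_eq_of_inter hD hD' hb ⟨x, hx, hx'⟩

theorem not_nested_iff {C D : Set V} (hC : C ∈ endCutSystem G) (hD : D ∈ endCutSystem G) :
    ¬ Nested G (endCutSystem G) C D ↔ Crosses G (boundary G C) (boundary G D) := by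
  constructor
  · intro h
    by_contra h'
    exact h (nested_of_not_crosses hC hD fun h => h' (crosses_symm hD hC h))
  · exact fun h h' => not_crosses_of_nested hC h' (crosses_symm hC hD h)

/-- The cuts crossed by the separator `S`. -/
def crossed (G : SimpleGraph V) (S : Set V) : Set (Set V) :=
  {D | D ∈ endCutSystem G ∧ Crosses G S (boundary G D)}

/-- A crossing `S` meets two distinct cuts with the same boundary, so it contains a pair of vertices
separated by that boundary; `S` has finitely many pairs. -/
theorem finite_crossed {S : Set V} (hS : S.Finite) : (crossed G S).Finite := by
  refine (hS.biUnion fun x _ => hS.biUnion fun y _ =>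
    finite_cuts_separating (G := G) x y).subset ?_
  rintro D ⟨hD, h⟩
  obtain ⟨D', hD', hb, hne⟩ := exists_other_cut hD
  obtain ⟨x, hxD, hx⟩ := h D hD rfl
  obtain ⟨y, hyD, hy⟩ := h D' hD' hb
  exact Set.mem_biUnion hx (Set.mem_biUnion hy ⟨hD, hxD, D', hD', hb, hne, hyD⟩)

theorem mu_eq {C : Set V} (hC : C ∈ endCutSystem G) :
    mu G (endCutSystem G) C = ((crossed G (boundary G C)).ncard : ℕ∞) := by
  rw [(finite_crossed (cut_finite hC)).cast_ncard_eq, mu]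
  congr 1
  ext D
  exact and_congr_right fun hD => not_nested_iff hC hD

/-! ### Corners of crossing cuts -/

theorem boundary_inter_subset (C D : Set V) : boundary G (C ∩ D) ⊆
    (C ∩ boundary G D) ∪ (D ∩ boundary G C) ∪ (boundary G C ∩ boundary G D) := by
  rintro v ⟨hv, w, hw, hvw⟩
  have h1 := mem_or_mem_boundary_of_adj hw.1 hvw.symm
  have h2 := mem_or_mem_boundary_of_adj hw.2 hvw.symm
  have h3 : ¬ (v ∈ C ∧ v ∈ D) := hv
  simp only [Set.mem_union, Set.mem_inter_iff]
  tauto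

theorem finite_boundary_inter {C D : Set V} (hC : (boundary G C).Finite)
    (hD : (boundary G D).Finite) : (boundary G (C ∩ D)).Finite :=
  (((hD.subset Set.inter_subset_right).union (hC.subset Set.inter_subset_right)).union
    (hC.subset Set.inter_subset_left)).subset (boundary_inter_subset C D)

theorem ncard_boundary_inter_le {C D : Set V} (hC : (boundary G C).Finite)
    (hD : (boundary G D).Finite) : (boundary G (C ∩ D)).ncard ≤
      (C ∩ boundary G D).ncard + (D ∩ boundary G C).ncard +
        (boundary G C ∩ boundary G D).ncard := by
  refine (Set.ncard_le_ncard (boundary_inter_subset C D)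
    (((hD.subset Set.inter_subset_right).union (hC.subset Set.inter_subset_right)).union
    (hC.subset Set.inter_subset_left))).trans ?_
  refine (Set.ncard_union_le _ _).trans ?_
  gcongr
  exact Set.ncard_union_le _ _

/-- The second conjunct is the equality case. It later forces a separator to avoid all components
other than the two considered. -/
theorem ncard_add_ncard_add_ncard_le {T A B S : Set V} (hT : T.Finite) (hAB : Disjoint A B)
    (hAS : Disjoint A S) (hBS : Disjoint B S) :
    (A ∩ T).ncard + (B ∩ T).ncard + (S ∩ T).ncard ≤ T.ncard ∧
      (T.ncard ≤ (A ∩ T).ncard + (B ∩ T).ncard + (S ∩ T).ncard → T ⊆ A ∪ B ∪ S) := by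
  have e1 : ((A ∪ B) ∩ T).ncard = (A ∩ T).ncard + (B ∩ T).ncard := by
    rw [Set.union_inter_distrib_right]
    exact Set.ncard_union_eq (hAB.mono Set.inter_subset_left Set.inter_subset_left)
      (hT.subset Set.inter_subset_right) (hT.subset Set.inter_subset_right)
  have e2 : ((A ∪ B ∪ S) ∩ T).ncard = (A ∩ T).ncard + (B ∩ T).ncard + (S ∩ T).ncard := by
    rw [Set.union_inter_distrib_right, Set.ncard_union_eq
      ((Set.disjoint_union_left.2 ⟨hAS, hBS⟩).mono Set.inter_subset_left Set.inter_subset_left)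
      (hT.subset Set.inter_subset_right) (hT.subset Set.inter_subset_right), e1]
  rw [← e2]
  refine ⟨Set.ncard_le_ncard Set.inter_subset_right hT, fun h => ?_⟩
  exact Set.inter_eq_right.1 (Set.eq_of_subset_of_ncard_le Set.inter_subset_right h hT)

section corners

variable {C₁ C₂ D₁ D₂ : Set V}

/-- If two opposite corners contain ends, then their boundaries are of least size and the two
separators meet only the four given cuts. -/
theorem opposite_corners (hC₁ : C₁ ∈ endCutSystem G) (hC₂ : C₂ ∈ endCutSystem G)
    (hD₁ : D₁ ∈ endCutSystem G) (hD₂ : D₂ ∈ endCutSystem G)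
    (hC : boundary G C₁ = boundary G C₂) (hD : boundary G D₁ = boundary G D₂)
    (hCne : C₁ ≠ C₂) (hDne : D₁ ≠ D₂) {α β : VertexEnd G} (hα : α.LiesIn (C₁ ∩ D₁))
    (hβ : β.LiesIn (C₂ ∩ D₂)) :
    (boundary G (C₁ ∩ D₁)).ncard ≤ (boundary G C₁).ncard ∧
      (boundary G (C₂ ∩ D₂)).ncard ≤ (boundary G C₁).ncard ∧
      boundary G D₁ ⊆ C₁ ∪ C₂ ∪ boundary G C₁ ∧ boundary G C₁ ⊆ D₁ ∪ D₂ ∪ boundary G D₁ := by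
  have hfC := cut_finite hC₁
  have hfD := cut_finite hD₁
  have h1 := ncard_cut_le hC₁ (finite_boundary_inter hfC hfD) hα
    (hβ.mono (Set.inter_subset_left.trans
      ((cut_subset_star hC₂ hC₁ hC.symm hCne.symm).trans (star_anti Set.inter_subset_left))))
  have h2 := ncard_cut_le hC₁ (finite_boundary_inter (hC ▸ hfC) (hD ▸ hfD)) hβ
    (hα.mono (Set.inter_subset_left.trans
      ((cut_subset_star hC₁ hC₂ hC hCne).trans (star_anti Set.inter_subset_left))))
  have h3 := ncard_boundary_inter_le hfC hfD
  have h4 := ncard_boundary_inter_le (C := C₂) (D := D₂) (hC ▸ hfC) (hD ▸ hfD)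
  rw [← hC, ← hD] at h4
  have h5 := ncard_add_ncard_add_ncard_le hfD (cut_disjoint hC₁ hC₂ hC hCne)
    (disjoint_boundary C₁) (hC ▸ disjoint_boundary C₂)
  have h6 := ncard_add_ncard_add_ncard_le hfC (cut_disjoint hD₁ hD₂ hD hDne)
    (disjoint_boundary D₁) (hD ▸ disjoint_boundary D₂)
  have h7 := ncard_cut_eq hC₁ hD₁
  rw [Set.inter_comm (boundary G D₁)] at h6
  -- The two corner boundaries have at least 2κ elements together, and counting the links and the
  -- centre bounds them by `|NC₁| + |ND₁| = 2κ`. Equality therefore holds throughout.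
  refine ⟨by omega, by omega, h5.2 (by omega), h6.2 (by omega)⟩

theorem disjoint_or_disjoint_of_not_crosses (hC₁ : C₁ ∈ endCutSystem G)
    (hC₂ : C₂ ∈ endCutSystem G) (hC : boundary G C₁ = boundary G C₂) (hCne : C₁ ≠ C₂) {U : Set V}
    (hU : U ∈ boundary G '' endCutSystem G) (h : ¬ Crosses G (boundary G C₁) U) :
    Disjoint C₁ U ∨ Disjoint C₂ U := by
  obtain ⟨L, hL, hb, hs⟩ := exists_cut_boundary_subset hC₁ hU h
  by_cases hL1 : L = C₁
  · right
    refine Disjoint.mono_right hs (Set.disjoint_union_right.2 ⟨?_, hC ▸ disjoint_boundary C₂⟩)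
    exact (cut_disjoint hL hC₂ (hb.trans hC) (hL1 ▸ hCne)).symm
  · left
    refine Disjoint.mono_right hs (Set.disjoint_union_right.2 ⟨?_, disjoint_boundary C₁⟩)
    exact (cut_disjoint hL hC₁ hb hL1).symm

variable {K₁ K₂ : Set V}

/-- If `NE` misses `C₁` or `D₁`, it misses `K₁`. Otherwise it misses `C₂` and `D₂`, which intersect
and so lie in the same cut `L` bounded by `NE`; then `NC₁`, `ND₁` and hence `NK₁` lie in `L ∪ NE`.
-/
theorem not_crosses_corner (hC₁ : C₁ ∈ endCutSystem G) (hC₂ : C₂ ∈ endCutSystem G)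
    (hD₁ : D₁ ∈ endCutSystem G) (hD₂ : D₂ ∈ endCutSystem G)
    (hC : boundary G C₁ = boundary G C₂) (hD : boundary G D₁ = boundary G D₂)
    (hCne : C₁ ≠ C₂) (hDne : D₁ ≠ D₂) (hK₁ : K₁ ∈ endCutSystem G)
    (hK₁s : K₁ ⊆ C₁ ∩ D₁) (hK₂s : (C₂ ∩ D₂).Nonempty)
    (hb : boundary G K₁ ⊆ boundary G C₁ ∪ boundary G D₁) {E : Set V} (hE : E ∈ endCutSystem G)
    (h1 : ¬ Crosses G (boundary G C₁) (boundary G E))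
    (h2 : ¬ Crosses G (boundary G D₁) (boundary G E)) :
    ¬ Crosses G (boundary G K₁) (boundary G E) := by
  have aux : Disjoint K₁ (boundary G E) → ¬ Crosses G (boundary G K₁) (boundary G E) :=
    fun h h' => not_crosses_of_disjoint hK₁ h (crosses_symm hK₁ hE h')
  rcases disjoint_or_disjoint_of_not_crosses hC₁ hC₂ hC hCne ⟨E, hE, rfl⟩ h1 with h1 | h1
  · exact aux (h1.mono_left (hK₁s.trans Set.inter_subset_left))
  rcases disjoint_or_disjoint_of_not_crosses hD₁ hD₂ hD hDne ⟨E, hE, rfl⟩ h2 with h2 | h2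
  · exact aux (h2.mono_left (hK₁s.trans Set.inter_subset_right))
  obtain ⟨L, hL, hLb, hCL⟩ := exists_cut_superset hE hC₂ h1
  obtain ⟨L', hL', hLb', hDL⟩ := exists_cut_superset hE hD₂ h2
  obtain ⟨x, hx⟩ := hK₂s
  obtain rfl : L = L' := cut_eq_of_inter hL hL' (hLb.trans hLb'.symm) ⟨x, hCL hx.1, hDL hx.2⟩
  refine not_crosses_of_subset hE (cut_isComp' hL hLb) (hb.trans (Set.union_subset ?_ ?_))
  · rw [← hLb, hC]; exact Set.subset_union_right.trans (union_boundary_mono hCL)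
  · rw [← hLb, hD]; exact Set.subset_union_right.trans (union_boundary_mono hDL)

/-- The number of crossed cuts is strictly submodular on opposite corners of crossing
separators. -/
theorem ncard_crossed_corners_lt (hC₁ : C₁ ∈ endCutSystem G) (hC₂ : C₂ ∈ endCutSystem G)
    (hD₁ : D₁ ∈ endCutSystem G) (hD₂ : D₂ ∈ endCutSystem G)
    (hC : boundary G C₁ = boundary G C₂) (hD : boundary G D₁ = boundary G D₂)
    (hCne : C₁ ≠ C₂) (hDne : D₁ ≠ D₂) (hK₁ : K₁ ∈ endCutSystem G) (hK₂ : K₂ ∈ endCutSystem G)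
    (hK₁s : K₁ ⊆ C₁ ∩ D₁) (hK₂s : K₂ ⊆ C₂ ∩ D₂)
    (hb₁ : boundary G K₁ ⊆ boundary G C₁ ∪ boundary G D₁)
    (hb₂ : boundary G K₂ ⊆ boundary G C₁ ∪ boundary G D₁)
    (hcr : Crosses G (boundary G C₁) (boundary G D₁)) :
    (crossed G (boundary G K₁)).ncard + (crossed G (boundary G K₂)).ncard <
      (crossed G (boundary G C₁)).ncard + (crossed G (boundary G D₁)).ncard := by
  have f1 := finite_crossed (G := G) (cut_finite hK₁)
  have f2 := finite_crossed (G := G) (cut_finite hK₂)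
  have f3 := finite_crossed (G := G) (cut_finite hC₁)
  have f4 := finite_crossed (G := G) (cut_finite hD₁)
  rw [← Set.ncard_union_add_ncard_inter _ _ f1 f2, ← Set.ncard_union_add_ncard_inter _ _ f3 f4]
  have aux₁ : ∀ {E}, E ∈ endCutSystem G → Disjoint K₁ (boundary G E) →
      ¬ Crosses G (boundary G K₁) (boundary G E) :=
    fun hE h h' => not_crosses_of_disjoint hK₁ h (crosses_symm hK₁ hE h')
  have aux₂ : ∀ {E}, E ∈ endCutSystem G → Disjoint K₂ (boundary G E) →
      ¬ Crosses G (boundary G K₂) (boundary G E) :=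
    fun hE h h' => not_crosses_of_disjoint hK₂ h (crosses_symm hK₂ hE h')
  have hn₁ : (C₁ ∩ D₁).Nonempty := (cut_nonempty hK₁).mono hK₁s
  have hn₂ : (C₂ ∩ D₂).Nonempty := (cut_nonempty hK₂).mono hK₂s
  refine add_lt_add_of_lt_of_le (Set.ncard_lt_ncard ⟨?_, fun h => ?_⟩ (f3.union f4))
    (Set.ncard_le_ncard ?_ (f3.inter_of_left _))
  · rintro E (⟨hE, h⟩ | ⟨hE, h⟩)
    · by_contra h'
      simp only [crossed, Set.mem_union, Set.mem_ofPred_eq, hE, true_and, not_or] at h'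
      exact not_crosses_corner hC₁ hC₂ hD₁ hD₂ hC hD hCne hDne hK₁ hK₁s hn₂ hb₁ hE h'.1 h'.2 h
    · by_contra h'
      simp only [crossed, Set.mem_union, Set.mem_ofPred_eq, hE, true_and, not_or] at h'
      exact not_crosses_corner hC₂ hC₁ hD₂ hD₁ hC.symm hD.symm hCne.symm hDne.symm hK₂ hK₂s hn₁
        (hC ▸ hD ▸ hb₂) hE (hC ▸ h'.1) (hD ▸ h'.2) h
  -- Strictness comes from the cut `C₁` itself: it is crossed by `ND₁` but by neither corner, since
  -- `NC₁` misses both `K₁` and `K₂`.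
  · rcases h (Or.inr ⟨hC₁, crosses_symm hC₁ hD₁ hcr⟩) with h | h
    · exact aux₁ hC₁ ((disjoint_boundary C₁).mono_left (hK₁s.trans Set.inter_subset_left)) h.2
    · refine aux₂ hC₁ ?_ h.2
      rw [hC]
      exact (disjoint_boundary C₂).mono_left (hK₂s.trans Set.inter_subset_left)
  -- Cuts crossed by both corners are counted twice on the right as well: a separator not crossing
  -- `NE` has one of its two sides, and with it a corner, disjoint from `NE`.
  · rintro E ⟨⟨hE, h₁⟩, -, h₂⟩
    refine ⟨⟨hE, ?_⟩, hE, ?_⟩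
    · by_contra h'
      rcases disjoint_or_disjoint_of_not_crosses hC₁ hC₂ hC hCne ⟨E, hE, rfl⟩ h' with h | h
      · exact aux₁ hE (h.mono_left (hK₁s.trans Set.inter_subset_left)) h₁
      · exact aux₂ hE (h.mono_left (hK₂s.trans Set.inter_subset_left)) h₂
    · by_contra h'
      rcases disjoint_or_disjoint_of_not_crosses hD₁ hD₂ hD hDne ⟨E, hE, rfl⟩ h' with h | h
      · exact aux₁ hE (h.mono_left (hK₁s.trans Set.inter_subset_right)) h₁
      · exact aux₂ hE (h.mono_left (hK₂s.trans Set.inter_subset_right)) h₂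

/-- Crossing separators have opposite corners that contain ends. -/
theorem exists_opposite_corners {C D : Set V} (hC : C ∈ endCutSystem G)
    (hD : D ∈ endCutSystem G) : ∃ C₁ ∈ endCutSystem G, ∃ C₂ ∈ endCutSystem G,
      ∃ D₁ ∈ endCutSystem G, ∃ D₂ ∈ endCutSystem G,
      boundary G C₁ = boundary G C ∧ boundary G C₂ = boundary G C ∧
      boundary G D₁ = boundary G D ∧ boundary G D₂ = boundary G D ∧ C₁ ≠ C₂ ∧ D₁ ≠ D₂ ∧
      ∃ α β : VertexEnd G, α.LiesIn (C₁ ∩ D₁) ∧ β.LiesIn (C₂ ∩ D₂) := by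
  obtain ⟨C', hC', hb, hne⟩ := exists_other_cut hC
  obtain ⟨α, -, hα, -⟩ := cut_exists_ends hC
  obtain ⟨β, -, hβ, -⟩ := cut_exists_ends hC'
  obtain ⟨D₁, hD₁, hDb₁, hα'⟩ := exists_cut_of_end hD α
  obtain ⟨D₂, hD₂, hDb₂, hβ'⟩ := exists_cut_of_end hD β
  -- If ends from two different cuts bounded by `NC` share a side of `ND`, an end `γ` on another
  -- side of `ND` is opposite to at least one of them.
  by_cases hDD : D₁ = D₂
  · subst hDD
    obtain ⟨D₃, hD₃, hDb₃, hne₃⟩ := exists_other_cut hD₁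
    obtain ⟨γ, -, hγ, -⟩ := cut_exists_ends hD₃
    obtain ⟨C₃, hC₃, hCb₃, hγ'⟩ := exists_cut_of_end hC γ
    by_cases h3 : C₃ = C
    · subst h3
      exact ⟨C', hC', _, hC₃, D₁, hD₁, D₃, hD₃, hb, hCb₃, hDb₁, hDb₃.trans hDb₁, hne, hne₃.symm,
        β, γ, hβ.inter hβ', hγ'.inter hγ⟩
    · exact ⟨C, hC, C₃, hC₃, D₁, hD₁, D₃, hD₃, rfl, hCb₃, hDb₁, hDb₃.trans hDb₁, Ne.symm h3,
        hne₃.symm, α, γ, hα.inter hα', hγ'.inter hγ⟩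
  · exact ⟨C, hC, C', hC', D₁, hD₁, D₂, hD₂, rfl, hb, hDb₁, hDb₂, hne.symm, hDD, α, β,
      hα.inter hα', hβ.inter hβ'⟩

/-- Combined with the equality case in `opposite_corners`, this shows that a crossed separator
bounds only two thin cuts, so that two crossing separators have just four corners to consider. -/
theorem eq_or_eq_of_crosses (hC₁ : C₁ ∈ endCutSystem G) (hC₂ : C₂ ∈ endCutSystem G)
    (hC : boundary G C₁ = boundary G C₂) {T : Set V} (hT : T ⊆ C₁ ∪ C₂ ∪ boundary G C₁)
    (hcr : Crosses G T (boundary G C₁)) {C : Set V} (hCc : C ∈ endCutSystem G)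
    (hb : boundary G C = boundary G C₁) : C = C₁ ∨ C = C₂ := by
  obtain ⟨x, hx, hxT⟩ := hcr C hCc hb
  rcases hT hxT with (h | h) | h
  · exact Or.inl (cut_eq_of_inter hCc hC₁ hb ⟨x, hx, h⟩)
  · exact Or.inr (cut_eq_of_inter hCc hC₂ (hb.trans hC) ⟨x, hx, h⟩)
  · exact absurd (hb ▸ h) fun h => Set.disjoint_left.1 (disjoint_boundary C) hx h

end corners

/-- `H i j` says that a corner contains an end, `m i j` is its value, and `x`, `y` are the values of
the two crossing cuts. If `a = b`, a corner bounded below by `x` is opposite to one bounded below by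
`y`, against strict submodularity; likewise if `p = q`. Otherwise one diagonal gives `2x < x + y`
and one gives `2y < x + y`. -/
theorem corner_values_contradiction (H : Bool → Bool → Prop) (m : Bool → Bool → ℕ) (x y : ℕ)
    (hlt : ∀ i j, H i j → H (!i) (!j) → m i j + m (!i) (!j) < x + y)
    {a b p q : Bool} (ha : H true a) (hb : H false b) (hp : H p true) (hq : H q false)
    (hxa : H false (!a) → x ≤ m true a) (hxb : H true (!b) → x ≤ m false b)
    (hyp : H (!p) false → y ≤ m p true) (hyq : H (!q) true → y ≤ m q false) : False := by
  have h1 := hlt true true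
  have h2 := hlt true false
  cases a <;> cases b <;> cases p <;> cases q <;> simp_all <;> omega

/-! ### The optimally nested cuts are nested -/

section nested

variable {C D : Set V}

theorem nestedSubsystem_exists_ends (hC : C ∈ nestedSubsystem G) :
    ∃ ω₁ ω₂ : VertexEnd G, ω₁.LiesIn C ∧ ω₂.LiesIn (star G C) ∧
      ∀ D ∈ endCutSystem G, SeparatesEnds G D ω₁ ω₂ →
        (crossed G (boundary G C)).ncard ≤ (crossed G (boundary G D)).ncard := by
  obtain ⟨hC, ω₁, ω₂, h, hmin⟩ := hC
  have key : ∀ D ∈ endCutSystem G, SeparatesEnds G D ω₁ ω₂ →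
      (crossed G (boundary G C)).ncard ≤ (crossed G (boundary G D)).ncard := fun D hD h => by
    have := hmin D hD h
    rw [mu_eq hC, mu_eq hD] at this
    exact_mod_cast this
  rcases h with ⟨h₁, h₂⟩ | ⟨h₁, h₂⟩
  · exact ⟨ω₁, ω₂, h₁, h₂, key⟩
  · exact ⟨ω₂, ω₁, h₁, h₂, fun D hD h => key D hD h.symm⟩

/-- Let `C₁`, `C₂` be the cuts with the same boundary as the optimally nested cut `C`. Then two
corners, one in each of `C₁`, `C₂`, contain ends and have at least as many crossed cuts as `C`
whenever the opposite corner contains an end. -/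
theorem exists_corner_bounds (hC : C ∈ nestedSubsystem G) {Cf Df : Bool → Set V}
    (hCf : ∀ L ∈ endCutSystem G, boundary G L = boundary G C → ∃ i, L = Cf i)
    (hDc : ∀ ω : VertexEnd G, ∃ j, ω.LiesIn (Df j))
    (hcorner : ∀ i j, ∀ ω ω' : VertexEnd G, ω.LiesIn (Cf i ∩ Df j) →
      ω'.LiesIn (Cf (!i) ∩ Df (!j)) → ∃ K ∈ endCutSystem G, K ⊆ Cf i ∩ Df j ∧
        boundary G K = boundary G (Cf i ∩ Df j) ∧ ω.LiesIn K) :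
    ∃ a b, (∃ ω : VertexEnd G, ω.LiesIn (Cf true ∩ Df a)) ∧
      (∃ ω : VertexEnd G, ω.LiesIn (Cf false ∩ Df b)) ∧
      ((∃ ω : VertexEnd G, ω.LiesIn (Cf false ∩ Df (!a))) → (crossed G (boundary G C)).ncard ≤
        (crossed G (boundary G (Cf true ∩ Df a))).ncard) ∧
      ((∃ ω : VertexEnd G, ω.LiesIn (Cf true ∩ Df (!b))) → (crossed G (boundary G C)).ncard ≤
        (crossed G (boundary G (Cf false ∩ Df b))).ncard) := by
  obtain ⟨ω₁, ω₂, h₁, h₂, hmin⟩ := nestedSubsystem_exists_ends hC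
  have hC := hC.1
  obtain ⟨L, hL, hLb, h₂'⟩ := exists_cut_of_end hC ω₂
  have hne : L ≠ C := fun e => (e ▸ h₂').not_star h₂
  obtain ⟨i, rfl⟩ := hCf C hC rfl
  obtain ⟨k, rfl⟩ := hCf L hL hLb
  obtain rfl : k = !i := by
    cases i <;> cases k <;> simp_all
  obtain ⟨a, ha⟩ := hDc ω₁
  obtain ⟨b, hb⟩ := hDc ω₂
  have hsub₁ : Cf (!i) ⊆ star G (Cf i) := cut_subset_star hL hC hLb hne
  have hsub₂ : Cf i ⊆ star G (Cf (!i)) := cut_subset_star hC hL hLb.symm hne.symm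
  have k₁ : (∃ ω : VertexEnd G, ω.LiesIn (Cf (!i) ∩ Df (!a))) →
      (crossed G (boundary G (Cf i))).ncard ≤
        (crossed G (boundary G (Cf i ∩ Df a))).ncard := by
    rintro ⟨ω, hω⟩
    obtain ⟨K, hK, hKs, hKb, hωK⟩ := hcorner i a ω₁ ω (h₁.inter ha) hω
    rw [← hKb]
    exact hmin K hK (Or.inl ⟨hωK, h₂'.mono
      (hsub₁.trans (star_anti (hKs.trans Set.inter_subset_left)))⟩)
  have k₂ : (∃ ω : VertexEnd G, ω.LiesIn (Cf i ∩ Df (!b))) →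
      (crossed G (boundary G (Cf i))).ncard ≤
        (crossed G (boundary G (Cf (!i) ∩ Df b))).ncard := by
    rintro ⟨ω, hω⟩
    obtain ⟨K, hK, hKs, hKb, hωK⟩ := hcorner (!i) b ω₂ ω (h₂'.inter hb) (by rwa [Bool.not_not])
    rw [← hKb]
    exact hmin K hK (Or.inr ⟨hωK, h₁.mono
      (hsub₂.trans (star_anti (hKs.trans Set.inter_subset_left)))⟩)
  cases i
  · exact ⟨b, a, ⟨ω₂, h₂'.inter hb⟩, ⟨ω₁, h₁.inter ha⟩, k₂, k₁⟩
  · exact ⟨a, b, ⟨ω₁, h₁.inter ha⟩, ⟨ω₂, h₂'.inter hb⟩, k₁, k₂⟩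

theorem not_crosses_of_mem_nestedSubsystem (hC : C ∈ nestedSubsystem G)
    (hD : D ∈ nestedSubsystem G) : ¬ Crosses G (boundary G C) (boundary G D) := by
  intro hcr
  obtain ⟨C₁, hC₁, C₂, hC₂, D₁, hD₁, D₂, hD₂, hb₁, hb₂, hd₁, hd₂, hCne, hDne, α, β, hα, hβ⟩ :=
    exists_opposite_corners hC.1 hD.1
  have hcr' := crosses_symm hC.1 hD.1 hcr
  obtain ⟨-, -, hs₁, hs₂⟩ := opposite_corners hC₁ hC₂ hD₁ hD₂ (hb₁.trans hb₂.symm)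
    (hd₁.trans hd₂.symm) hCne hDne hα hβ
  have hCe : ∀ L ∈ endCutSystem G, boundary G L = boundary G C → L = C₁ ∨ L = C₂ :=
    fun L hL hLb => eq_or_eq_of_crosses hC₁ hC₂ (hb₁.trans hb₂.symm) hs₁
      (by rwa [hb₁, hd₁]) hL (hLb.trans hb₁.symm)
  have hDe : ∀ L ∈ endCutSystem G, boundary G L = boundary G D → L = D₁ ∨ L = D₂ :=
    fun L hL hLb => eq_or_eq_of_crosses hD₁ hD₂ (hd₁.trans hd₂.symm) hs₂
      (by rwa [hb₁, hd₁]) hL (hLb.trans hd₁.symm)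
  set Cf : Bool → Set V := fun i => bif i then C₁ else C₂ with hCf
  set Df : Bool → Set V := fun i => bif i then D₁ else D₂ with hDf
  have cC : ∀ i, Cf i ∈ endCutSystem G := by rintro (_ | _) <;> assumption
  have cD : ∀ i, Df i ∈ endCutSystem G := by rintro (_ | _) <;> assumption
  have bC : ∀ i, boundary G (Cf i) = boundary G C := by rintro (_ | _) <;> assumption
  have bD : ∀ i, boundary G (Df i) = boundary G D := by rintro (_ | _) <;> assumption
  have nC : ∀ i, Cf i ≠ Cf !i := by rintro (_ | _); exacts [hCne.symm, hCne]
  have nD : ∀ i, Df i ≠ Df !i := by rintro (_ | _); exacts [hDne.symm, hDne]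
  have eC : ∀ L ∈ endCutSystem G, boundary G L = boundary G C → ∃ i, L = Cf i :=
    fun L hL hLb => (hCe L hL hLb).elim (fun h => ⟨true, h⟩) (fun h => ⟨false, h⟩)
  have eD : ∀ L ∈ endCutSystem G, boundary G L = boundary G D → ∃ i, L = Df i :=
    fun L hL hLb => (hDe L hL hLb).elim (fun h => ⟨true, h⟩) (fun h => ⟨false, h⟩)
  have lC : ∀ ω : VertexEnd G, ∃ i, ω.LiesIn (Cf i) := fun ω => by
    obtain ⟨L, hL, hLb, h⟩ := exists_cut_of_end hC.1 ω
    obtain ⟨i, rfl⟩ := eC L hL hLb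
    exact ⟨i, h⟩
  have lD : ∀ ω : VertexEnd G, ∃ i, ω.LiesIn (Df i) := fun ω => by
    obtain ⟨L, hL, hLb, h⟩ := exists_cut_of_end hD.1 ω
    obtain ⟨i, rfl⟩ := eD L hL hLb
    exact ⟨i, h⟩
  have corner : ∀ i j, ∀ ω ω' : VertexEnd G, ω.LiesIn (Cf i ∩ Df j) →
      ω'.LiesIn (Cf (!i) ∩ Df (!j)) → ∃ K ∈ endCutSystem G, K ⊆ Cf i ∩ Df j ∧
        boundary G K = boundary G (Cf i ∩ Df j) ∧ ω.LiesIn K := by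
    intro i j ω ω' hω hω'
    have := opposite_corners (cC i) (cC !i) (cD j) (cD !j) ((bC _).trans (bC _).symm)
      ((bD _).trans (bD _).symm) (nC i) (nD j) hω hω'
    obtain ⟨K, hK, hKs, hKb, hωK, -⟩ := exists_cut_of_ncard_le (cC i)
      (finite_boundary_inter (cut_finite (cC i)) (cut_finite (cD j))) hω
      (hω'.mono (Set.inter_subset_left.trans ((cut_subset_star (cC _) (cC _)
        ((bC _).trans (bC _).symm) (nC i).symm).trans (star_anti Set.inter_subset_left)))) this.1
    exact ⟨K, hK, hKs, hKb, hωK⟩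
  obtain ⟨a, b, ha, hb, hxa, hxb⟩ := exists_corner_bounds hC eC lD corner
  obtain ⟨p, q, hp, hq, hyp, hyq⟩ := exists_corner_bounds hD (Cf := Df) (Df := Cf) eD lC
    (fun i j ω ω' h h' => by
      rw [Set.inter_comm] at h h' ⊢
      exact corner j i ω ω' h h')
  simp only [Set.inter_comm (Df _)] at hp hq hyp hyq
  refine corner_values_contradiction (fun i j => ∃ ω : VertexEnd G, ω.LiesIn (Cf i ∩ Df j))
    (fun i j => (crossed G (boundary G (Cf i ∩ Df j))).ncard) _ _ ?_ ha hb hp hq hxa hxb hyp hyq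
  rintro i j ⟨ω, hω⟩ ⟨ω', hω'⟩
  obtain ⟨K, hK, hKs, hKb, -⟩ := corner i j ω ω' hω hω'
  obtain ⟨K', hK', hKs', hKb', -⟩ := corner (!i) (!j) ω' ω hω' (by simpa using hω)
  have hsub : ∀ i j, boundary G (Cf i ∩ Df j) ⊆ boundary G C ∪ boundary G D := fun i j => by
    refine (boundary_inter_subset _ _).trans ?_
    rw [bC, bD]
    rintro x ((hx | hx) | hx)
    exacts [Or.inr hx.2, Or.inl hx.2, Or.inl hx.1]
  have := ncard_crossed_corners_lt (cC i) (cC !i) (cD j) (cD !j) ((bC _).trans (bC _).symm)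
      ((bD _).trans (bD _).symm) (nC i) (nD j) hK hK' hKs hKs'
      (by rw [hKb, bC i, bD j]; exact hsub i j) (by rw [hKb', bC i, bD j]; exact hsub _ _)
      (by rwa [bC, bD])
  rwa [hKb, hKb', bC, bD] at this

/-- A thin cut with the same boundary as an optimally nested cut is optimally nested. -/
theorem mem_nestedSubsystem_of_boundary_eq (hC : C ∈ nestedSubsystem G)
    (hD : D ∈ endCutSystem G) (hb : boundary G D = boundary G C) : D ∈ nestedSubsystem G := by
  by_cases hDC : D = C
  · exact hDC ▸ hC
  have hmu : mu G (endCutSystem G) D = mu G (endCutSystem G) C := by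
    rw [mu_eq hD, mu_eq hC.1, hb]
  -- If `NC` crosses something, only two cuts have this boundary, so `C` and `D` separate the same
  -- relevant ends. If it crosses nothing, `μ(D) = 0` is minimal for any pair of ends separated by
  -- `D`.
  by_cases hE : ∃ E ∈ endCutSystem G, Crosses G (boundary G C) (boundary G E)
  · obtain ⟨E, hE, hcr⟩ := hE
    obtain ⟨C₁, hC₁, C₂, hC₂, D₁, hD₁, D₂, hD₂, hb₁, hb₂, hd₁, hd₂, hCne, hDne, α, β, hα, hβ⟩ :=
      exists_opposite_corners hC.1 hE
    obtain ⟨-, -, hs₁, -⟩ := opposite_corners hC₁ hC₂ hD₁ hD₂ (hb₁.trans hb₂.symm)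
      (hd₁.trans hd₂.symm) hCne hDne hα hβ
    have hCe : ∀ L ∈ endCutSystem G, boundary G L = boundary G C → L = C₁ ∨ L = C₂ :=
      fun L hL hLb => eq_or_eq_of_crosses hC₁ hC₂ (hb₁.trans hb₂.symm) hs₁
        (by rw [hb₁, hd₁]; exact crosses_symm hC.1 hE hcr) hL (hLb.trans hb₁.symm)
    have hsep : ∀ ω₁ ω₂ : VertexEnd G, ω₁.LiesIn C → ω₂.LiesIn (star G C) →
        ω₂.LiesIn D ∧ ω₁.LiesIn (star G D) := by
      intro ω₁ ω₂ h₁ h₂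
      obtain ⟨L, hL, hLb, hL₂⟩ := exists_cut_of_end hC.1 ω₂
      have hLC : L ≠ C := fun e => (e ▸ hL₂).not_star h₂
      obtain rfl : L = D := by
        rcases hCe L hL hLb with h1 | h1 <;> rcases hCe D hD hb with h2 | h2 <;>
          rcases hCe C hC.1 rfl with h3 | h3 <;> simp_all
      exact ⟨hL₂, h₁.mono (cut_subset_star hC.1 hL hLb.symm hLC.symm)⟩
    obtain ⟨-, ω₁, ω₂, h, hmin⟩ := hC
    refine ⟨hD, ω₁, ω₂, ?_, fun F hF h => hmu ▸ hmin F hF h⟩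
    rcases h with ⟨h₁, h₂⟩ | ⟨h₁, h₂⟩
    · exact Or.inr (hsep _ _ h₁ h₂)
    · exact Or.inl (hsep _ _ h₁ h₂)
  · obtain ⟨ω₁, ω₂, h₁, h₂⟩ := cut_exists_ends hD
    refine ⟨hD, ω₁, ω₂, Or.inl ⟨h₁, h₂⟩, fun F _ _ => ?_⟩
    have : crossed G (boundary G D) = ∅ := by
      rw [Set.eq_empty_iff_forall_notMem]
      rintro E ⟨hE', h⟩
      exact hE ⟨E, hE', hb ▸ h⟩
    rw [mu_eq hD, this]
    simp

end nested

/-! ### Optimally nested cuts and blocks -/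

section sides

variable {C D E : Set V}

theorem exists_nested_of_end (hC : C ∈ nestedSubsystem G) (ω : VertexEnd G) :
    ∃ K ∈ nestedSubsystem G, boundary G K = boundary G C ∧ ω.LiesIn K := by
  obtain ⟨K, hK, hb, hω⟩ := exists_cut_of_end hC.1 ω
  exact ⟨K, mem_nestedSubsystem_of_boundary_eq hC hK hb, hb, hω⟩

/-- Each separator lies on one side of every other separator. -/
theorem exists_nested_toward (hC : C ∈ nestedSubsystem G) (hD : D ∈ nestedSubsystem G) :
    ∃ L ∈ nestedSubsystem G, boundary G L = boundary G C ∧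
      boundary G D ⊆ L ∪ boundary G C := by
  obtain ⟨L, hL, hb, hs⟩ := exists_cut_boundary_subset hC.1 ⟨D, hD.1, rfl⟩
    (not_crosses_of_mem_nestedSubsystem hC hD)
  exact ⟨L, mem_nestedSubsystem_of_boundary_eq hC hL hb, hb, hs⟩

theorem cut_subset_of_end (hD : D ∈ endCutSystem G)
    (h : Disjoint D (boundary G C)) {ω : VertexEnd G} (h₁ : ω.LiesIn C) (h₂ : ω.LiesIn D) :
    D ⊆ C :=
  connected_subset (cut_connected hD) (h₂.inter h₁).nonempty h

theorem disjoint_of_subset_union (hC : C ∈ endCutSystem G) (hD : D ∈ endCutSystem G)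
    (hb : boundary G C = boundary G D) (hne : C ≠ D) {Y : Set V} (hY : Y ⊆ D ∪ boundary G D) :
    Disjoint C Y :=
  Disjoint.mono_right hY (Set.disjoint_union_right.2
    ⟨cut_disjoint hC hD hb hne, hb ▸ disjoint_boundary C⟩)

theorem subset_boundary_of_subset_of_subset (hC : C ∈ endCutSystem G) (hD : D ∈ endCutSystem G)
    (hb : boundary G C = boundary G D) (hne : C ≠ D) {Y : Set V} (hY : Y ⊆ C ∪ boundary G C)
    (hY' : Y ⊆ D ∪ boundary G D) : Y ⊆ boundary G C := fun _ hy =>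
  (hY hy).resolve_left fun h =>
    Set.disjoint_left.1 (disjoint_of_subset_union hC hD hb hne hY') h hy

theorem subset_boundary_of_subset_star {Y : Set V} (hY : Y ⊆ C ∪ boundary G C)
    (hY' : Y ⊆ star G C ∪ boundary G C) : Y ⊆ boundary G C := fun _ hy =>
  (hY hy).elim (fun h => (hY' hy).resolve_left fun h' =>
    Set.disjoint_left.1 (disjoint_star C) h h') id

theorem exists_other_superset (hC : C ∈ endCutSystem G) (hD : D ∈ endCutSystem G)
    (hE : E ∈ endCutSystem G) (hs : C ⊆ D) (hb : boundary G E = boundary G D) (hne : E ≠ D) :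
    ∃ L ∈ endCutSystem G, boundary G L = boundary G C ∧ L ≠ C ∧ E ⊆ L := by
  have h1 := disjoint_of_subset_union hE hD hb hne (union_boundary_mono hs)
  obtain ⟨L, hL, hLb, hEL⟩ := exists_cut_superset hC hE (h1.mono_right Set.subset_union_right)
  obtain ⟨x, hx⟩ := cut_nonempty hE
  exact ⟨L, hL, hLb, fun e => Set.disjoint_left.1 h1 hx (Or.inl (e ▸ hEL hx)), hEL⟩

/-- Only finitely many cuts contain a given vertex and lie in a given cut. -/
theorem finite_cuts_between (hD : D ∈ endCutSystem G) (x : V) :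
    {C | C ∈ endCutSystem G ∧ x ∈ C ∧ C ⊆ D}.Finite := by
  -- A vertex `y` beyond `D` is separated from `x` by the boundary of every cut between, so the
  -- count of separating cuts applies.
  obtain ⟨E, hE, hb, hne⟩ := exists_other_cut hD
  obtain ⟨y, hy⟩ := cut_nonempty hE
  refine (finite_cuts_separating (G := G) x y).subset ?_
  rintro C ⟨hC, hx, hs⟩
  obtain ⟨L, hL, hLb, hLne, hEL⟩ := exists_other_superset hC hD hE hs hb hne
  exact ⟨hC, hx, L, hL, hLb, hLne, hEL hy⟩

end sides

section blocks

variable {B B' C D : Set V}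

theorem IsBlock.not_subset_boundary (hB : IsBlock G (nestedSubsystem G) B)
    (hC : C ∈ nestedSubsystem G) : ¬ B ⊆ boundary G C := by
  intro h
  rcases hB.maximal.prop C hC with ⟨-, h'⟩ | ⟨-, h'⟩
  · exact h' (h.trans Set.subset_union_right)
  · exact h' (h.trans Set.subset_union_right)

theorem IsBlock.exists_side (hB : IsBlock G (nestedSubsystem G) B)
    (hC : C ∈ nestedSubsystem G) :
    ∃ K ∈ nestedSubsystem G, boundary G K = boundary G C ∧ B ⊆ K ∪ boundary G K := by
  obtain ⟨v, hv, hvC⟩ := Set.not_subset.1 (hB.not_subset_boundary hC)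
  obtain ⟨K, hK, hvK⟩ := IsComp.exists_mem (G := G) hvC
  -- Here disjointness from slices is used: the component of a vertex of `B` outside the separator
  -- must be a cut.
  have hKN : K ∈ nestedSubsystem G := by
    by_contra h
    exact Set.disjoint_left.1 (hB.disjoint K ⟨h, _, ⟨C, hC, rfl⟩, hK.exists_componentCompl⟩) hv hvK
  refine ⟨K, hKN, boundary_eq_of_subset hKN.1 hC.1 hK.boundary_subset, ?_⟩
  rcases hB.maximal.prop K hKN with ⟨h, -⟩ | ⟨h, -⟩
  · exact h
  · rcases h hv with h | h
    · exact absurd hvK (mem_star_iff.1 h).1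
    · exact absurd hvK h.1

theorem IsBlock.side_unique (hB : IsBlock G (nestedSubsystem G) B)
    (hC : C ∈ nestedSubsystem G) (hD : D ∈ nestedSubsystem G)
    (hb : boundary G C = boundary G D) (h : B ⊆ C ∪ boundary G C)
    (h' : B ⊆ D ∪ boundary G D) : C = D := by
  by_contra hne
  exact hB.not_subset_boundary hC (subset_boundary_of_subset_of_subset hC.1 hD.1 hb hne h h')

/-- A block is determined by the cuts that point towards it. -/
theorem IsBlock.eq_of_forall (hB : IsBlock G (nestedSubsystem G) B)
    (hB' : IsBlock G (nestedSubsystem G) B')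
    (h : ∀ C ∈ nestedSubsystem G, B ⊆ C ∪ boundary G C → B' ⊆ C ∪ boundary G C) : B = B' := by
  have hins : Inseparable G (nestedSubsystem G) (B ∪ B') := by
    intro C hC
    rcases hB.maximal.prop C hC with ⟨h1, h2⟩ | ⟨h1, h2⟩
    · exact Or.inl ⟨Set.union_subset h1 (h C hC h1),
        fun h' => h2 (Set.subset_union_left.trans h')⟩
    · obtain ⟨K, hK, hKb, hBK⟩ := hB.exists_side hC
      have hne : K ≠ C := fun e => h2 (e ▸ hBK)
      have hB'K := h K hK hBK
      refine Or.inr ⟨Set.union_subset h1 (hB'K.trans ?_),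
        fun h' => h2 (Set.subset_union_left.trans h')⟩
      rw [hKb]
      exact Set.union_subset_union_left _ (cut_subset_star hK.1 hC.1 hKb hne)
  exact (hB.maximal.eq_of_subset hins Set.subset_union_left).trans
    (hB'.maximal.eq_of_subset hins Set.subset_union_right).symm

/-- An edge of T determines its block: any separator other than `NC` has both blocks on the side
where `NC` lies, because `NC` is contained in both of them and not in that separator. -/
theorem IsBlock.eq_of_boundary_subset (hB : IsBlock G (nestedSubsystem G) B)
    (hB' : IsBlock G (nestedSubsystem G) B') (hC : C ∈ nestedSubsystem G)
    (hCB : boundary G C ⊆ B) (hCB' : boundary G C ⊆ B') (h : B ⊆ C ∪ boundary G C)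
    (h' : B' ⊆ C ∪ boundary G C) : B = B' := by
  refine hB.eq_of_forall hB' fun D hD hBD => ?_
  obtain ⟨K, hK, hKb, hBK⟩ := hB'.exists_side hD
  suffices K = D from this ▸ hBK
  by_cases hDC : boundary G D = boundary G C
  · exact (hB'.side_unique hK hC (hKb.trans hDC) hBK h').trans
      (hB.side_unique hC hD hDC.symm h hBD)
  · by_contra hne
    have := subset_boundary_of_subset_of_subset hK.1 hD.1 hKb hne (hCB'.trans hBK) (hCB.trans hBD)
    exact hDC (hKb ▸ boundary_eq_of_subset hC.1 hK.1 this).symm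

/-- A choice `P` of cuts, at least one for each separator, whose sides have a common part that is
not contained in a separator, defines a block. -/
theorem isBlock_of_orientation {P : Set V → Prop}
    (hP : ∀ C ∈ nestedSubsystem G, ∃ K ∈ nestedSubsystem G, boundary G K = boundary G C ∧ P K)
    (hB : B = {v | ∀ C ∈ nestedSubsystem G, P C → v ∈ C ∪ boundary G C})
    (hne : ∀ C ∈ nestedSubsystem G, ¬ B ⊆ boundary G C) :
    IsBlock G (nestedSubsystem G) B ∧
      ∀ C ∈ nestedSubsystem G, P C ↔ B ⊆ C ∪ boundary G C := by
  have hsub : ∀ C ∈ nestedSubsystem G, P C → B ⊆ C ∪ boundary G C := by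
    intro C hC h v hv
    rw [hB] at hv
    exact hv C hC h
  have hiff : ∀ C ∈ nestedSubsystem G, P C ↔ B ⊆ C ∪ boundary G C := by
    refine fun C hC => ⟨hsub C hC, fun h => ?_⟩
    obtain ⟨K, hK, hKb, hPK⟩ := hP C hC
    by_cases hKC : K = C
    · exact hKC ▸ hPK
    · exact absurd (subset_boundary_of_subset_of_subset hK.1 hC.1 hKb hKC (hsub K hK hPK) h)
        (hne K hK)
  refine ⟨⟨⟨fun C hC => ?_, fun Y hY hBY v hv => ?_⟩, ?_⟩, hiff⟩
  · by_cases h : P C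
    · exact Or.inl ⟨hsub C hC h, fun h' =>
        hne C hC (subset_boundary_of_subset_star (hsub C hC h) h')⟩
    · refine Or.inr ⟨?_, fun h' => h ((hiff C hC).2 h')⟩
      obtain ⟨K, hK, hKb, hPK⟩ := hP C hC
      refine (hsub K hK hPK).trans ?_
      rw [hKb]
      exact Set.union_subset_union_left _ (cut_subset_star hK.1 hC.1 hKb fun e => h (e ▸ hPK))
  · rw [hB]
    intro C hC h
    rcases hY C hC with ⟨h', -⟩ | ⟨h', -⟩
    · exact h' hv
    · exact absurd (subset_boundary_of_subset_star (hsub C hC h) (hBY.trans h')) (hne C hC)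
  · rintro Q ⟨hQ, S, ⟨C, hC, rfl⟩, K', rfl⟩
    rw [Set.disjoint_left]
    intro v hv hvQ
    obtain ⟨K, hK, hKb, hPK⟩ := hP C hC
    have hcomp := IsComp.of_componentCompl K'
    rcases hsub K hK hPK hv with h | h
    · exact hQ ((cut_isComp' hK.1 hKb).eq_of_inter hcomp ⟨v, h, hvQ⟩ ▸ hK)
    · exact Set.disjoint_left.1 hcomp.disjoint hvQ (hKb ▸ h)

end blocks

/-! ### Descending sequences of cuts and ends -/

theorem exists_descent {A : Set V} (hA : (G.induce A).Connected) {x : V} (hx : x ∈ A) :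
    ∃ d : V → ℕ, ∀ v ∈ A, v ≠ x → ∃ w ∈ A, G.Adj v w ∧ d w < d v := by
  classical
  refine ⟨fun v => if h : v ∈ A then (G.induce A).dist ⟨v, h⟩ ⟨x, hx⟩ else 0, fun v hv hvx => ?_⟩
  obtain ⟨p, hp⟩ := hA.exists_walk_length_eq_dist ⟨v, hv⟩ ⟨x, hx⟩
  cases p with
  | nil => exact absurd rfl hvx
  | @cons _ w _ h p =>
    refine ⟨w, w.2, h, ?_⟩
    simp only [dif_pos w.2, dif_pos hv]
    rw [← hp]
    exact Nat.lt_succ_of_le (SimpleGraph.dist_le p)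

/-- Loop erasure: a sequence of successively adjacent vertices that visits each vertex finitely
often has a subsequence that is a ray. -/
theorem exists_ray_of_sequence {W : ℕ → V} (hW : ∀ n, G.Adj (W n) (W (n + 1)))
    (hfin : ∀ v, ∃ N, ∀ n ≥ N, W n ≠ v) :
    ∃ (R : Ray G) (f : ℕ → ℕ), StrictMono f ∧ ∀ n, R.vert n = W (f n) := by
  have hlast : ∀ m, ∃ m', m ≤ m' ∧ W m' = W m ∧ ∀ j, m' < j → W j ≠ W m := by
    intro m
    obtain ⟨N, hN⟩ := hfin (W m)
    have hbdd : BddAbove {j | W j = W m} := ⟨N, fun j hj => by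
      by_contra h
      exact hN j (by omega) hj⟩
    exact ⟨sSup {j | W j = W m}, le_csSup hbdd rfl, Nat.sSup_mem (s := {j | W j = W m}) ⟨m, rfl⟩ hbdd,
      fun j hj h => (le_csSup hbdd h).not_gt hj⟩
  choose l hl hlW hlast using hlast
  -- From the last visit to the current vertex, move one step and jump to the last visit to the
  -- vertex reached.
  let f : ℕ → ℕ := fun n => Nat.rec (l 0) (fun _ k => l (k + 1)) n
  have hf : ∀ n, f (n + 1) = l (f n + 1) := fun _ => rfl
  have hmono : StrictMono f := strictMono_nat_of_lt_succ fun n => by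
    rw [hf]; exact hl (f n + 1)
  have hlastf : ∀ n j, f n < j → W j ≠ W (f n) := by
    intro n
    cases n with
    | zero => intro j hj; exact (hlW 0).symm ▸ hlast 0 j hj
    | succ n => intro j hj; rw [hf] at hj ⊢; exact (hlW (f n + 1)).symm ▸ hlast _ j hj
  refine ⟨⟨fun n => W (f n), ?_, fun n => ?_⟩, f, hmono, fun _ => rfl⟩
  · intro a b hab
    rcases lt_trichotomy a b with h | h | h
    · exact absurd hab.symm (hlastf a _ (hmono h))
    · exact h
    · exact absurd hab (hlastf b _ (hmono h))
  · rw [hf, hlW]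
    exact hW _

/-- A strictly descending sequence of connected sets without common vertices contains a ray. -/
theorem exists_ray_of_descending {C : ℕ → Set V} (hc : ∀ n, (G.induce (C n)).Connected)
    (hs : ∀ n, C (n + 1) ⊂ C n) (hempty : ∀ x, ∃ n, x ∉ C n) :
    ∃ R : Ray G, ∀ n, R.EventuallyIn (C n) := by
  have hanti : Antitone C := antitone_nat_of_succ_le fun n => (hs n).1
  choose x hx hx' using fun n => Set.not_subset.1 (hs n).2
  choose d hd using fun n => exists_descent (hc n) (hanti (Nat.le_succ n) (hx (n + 1)))
  -- A state is a vertex together with a level `n`. At level `n` the walk stays in `C n` and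
  -- approaches `x (n + 1)`; on arrival the level rises by one. The distance to the target drops
  -- while the level is constant, so the levels are unbounded.
  have hstep : ∀ s : {s : V × ℕ // s.1 ∈ C s.2}, ∃ s' : {s : V × ℕ // s.1 ∈ C s.2},
      G.Adj s.1.1 s'.1.1 ∧ s.1.2 ≤ s'.1.2 ∧
        (s'.1.2 = s.1.2 → d s.1.2 s'.1.1 < d s.1.2 s.1.1) := by
    rintro ⟨⟨v, n⟩, hv⟩
    by_cases hvx : v = x (n + 1)
    · have hv' : v ∈ C (n + 1) := hvx ▸ hx (n + 1)
      have hne : v ≠ x (n + 1 + 1) := fun e => hx' (n + 1) (hvx ▸ e ▸ hx (n + 1 + 1))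
      obtain ⟨w, hw, hadj, -⟩ := hd (n + 1) v hv' hne
      exact ⟨⟨⟨w, n + 1⟩, hw⟩, hadj, Nat.le_succ n, fun h => absurd h (Nat.succ_ne_self n)⟩
    · obtain ⟨w, hw, hadj, hlt⟩ := hd n v hv hvx
      exact ⟨⟨⟨w, n⟩, hw⟩, hadj, le_rfl, fun _ => hlt⟩
  choose step hadj hle hlt using hstep
  let s : ℕ → {s : V × ℕ // s.1 ∈ C s.2} := fun n => step^[n] ⟨⟨x 0, 0⟩, hx 0⟩
  have hss : ∀ n, s (n + 1) = step (s n) := fun n => Function.iterate_succ_apply' step n _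
  have hmono : Monotone fun n => (s n).1.2 := monotone_nat_of_le_succ fun n => by
    rw [hss]; exact hle _
  have hunb : ∀ N, ∃ m, N ≤ (s m).1.2 := by
    intro N
    by_contra! hN
    obtain ⟨m, hm⟩ : ∃ m, ∀ k ≥ m, (s k).1.2 = (s m).1.2 := by
      have hbdd : BddAbove (Set.range fun n => (s n).1.2) :=
        ⟨N, by rintro _ ⟨k, rfl⟩; exact (hN k).le⟩
      obtain ⟨m, hm⟩ := Nat.sSup_mem (Set.range_nonempty _) hbdd
      refine ⟨m, fun k hk => le_antisymm ?_ (hmono hk)⟩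
      exact (le_csSup hbdd ⟨k, rfl⟩).trans hm.ge
    have hdec : ∀ k, d (s m).1.2 (s (m + k)).1.1 + k ≤ d (s m).1.2 (s m).1.1 := by
      intro k
      induction k with
      | zero => simp
      | succ k ih =>
        have h1 := hm (m + k) (by omega)
        have h2 := hm (m + k + 1) (by omega)
        have h3 := hlt (s (m + k)) (by rw [← hss, h1, h2])
        rw [← hss, h1] at h3
        change d (s m).1.2 (s (m + k + 1)).1.1 + (k + 1) ≤ _
        omega
    have := hdec (d (s m).1.2 (s m).1.1 + 1)
    omega
  have hev : ∀ n, ∃ m, ∀ k ≥ m, (s k).1.1 ∈ C n := fun n => by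
    obtain ⟨m, hm⟩ := hunb n
    exact ⟨m, fun k hk => hanti (hm.trans (hmono hk)) (s k).2⟩
  obtain ⟨R, f, hf, hR⟩ := exists_ray_of_sequence (W := fun n => (s n).1.1)
    (fun n => by rw [hss]; exact hadj _) (fun v => by
      obtain ⟨n, hn⟩ := hempty v
      obtain ⟨m, hm⟩ := hev n
      exact ⟨m, fun k hk e => hn (e ▸ hm k hk)⟩)
  refine ⟨R, fun n => ?_⟩
  obtain ⟨m, hm⟩ := hev n
  exact ⟨m, fun k hk => by rw [hR]; exact hm _ (hk.trans (hf.id_le k))⟩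

section descending

variable {C : ℕ → Set V}

theorem exists_notMem_of_descending (hC : ∀ n, C n ∈ endCutSystem G)
    (hs : ∀ n, C (n + 1) ⊂ C n) (x : V) : ∃ n, x ∉ C n := by
  by_contra! h
  have hanti : StrictAnti C := strictAnti_nat_of_succ_lt hs
  refine Set.infinite_range_of_injective hanti.injective
    ((finite_cuts_between (hC 0) x).subset ?_)
  rintro _ ⟨n, rfl⟩
  exact ⟨hC n, h n, hanti.antitone (Nat.zero_le n)⟩

theorem exists_disjoint_of_descending (hC : ∀ n, C n ∈ endCutSystem G)
    (hs : ∀ n, C (n + 1) ⊂ C n) {F : Set V} (hF : F.Finite) :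
    ∃ m, ∀ n ≥ m, Disjoint (C n) F := by
  have hanti : Antitone C := antitone_nat_of_succ_le fun n => (hs n).1
  choose g hg using exists_notMem_of_descending hC hs
  obtain ⟨m, hm⟩ := (hF.image g).bddAbove
  refine ⟨m, fun n hn => Set.disjoint_left.2 fun x hx hxF => hg x ?_⟩
  exact hanti ((hm ⟨x, hxF, rfl⟩).trans hn) hx

/-- For uniqueness, a set `Z` separating two such ends has finite boundary, which some `C n` misses.
Then `C n ⊆ Z`, although `C n` contains both ends. -/
theorem existsUnique_end_of_descending (hC : ∀ n, C n ∈ endCutSystem G)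
    (hs : ∀ n, C (n + 1) ⊂ C n) : ∃! ω : VertexEnd G, ∀ n, ω.LiesIn (C n) := by
  obtain ⟨R, hR⟩ := exists_ray_of_descending (fun n => cut_connected (hC n)) hs
    (exists_notMem_of_descending hC hs)
  refine ⟨R.toEnd, fun n => VertexEnd.liesIn_of_ray (cut_finite (hC n)) (hR n), fun ω hω => ?_⟩
  by_contra hne
  obtain ⟨Z, hZ, h₁, h₂⟩ := VertexEnd.exists_separating hne
  obtain ⟨n, hn⟩ := exists_disjoint_of_descending hC hs hZ
  have := connected_subset (cut_connected (hC n)) ((hω n).inter h₁).nonempty (hn n le_rfl)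
  exact ((VertexEnd.liesIn_of_ray (cut_finite (hC n)) (hR n)).mono this).not_star h₂

end descending

/-! ### Rays of the structure tree -/

/-- The blocks `B n`, the cuts `C n` and their boundaries form a ray of the structure tree that
starts in a separator. -/
structure IsCutPath (G : SimpleGraph V) (C B : ℕ → Set V) : Prop where
  cut : ∀ n, C n ∈ nestedSubsystem G
  block : ∀ n, IsBlock G (nestedSubsystem G) (B n)
  subset : ∀ n, B n ⊆ C n ∪ boundary G (C n)
  left : ∀ n, boundary G (C n) ⊆ B n
  right : ∀ n, boundary G (C (n + 1)) ⊆ B n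
  not_subset : ∀ n, ¬ B n ⊆ C (n + 1) ∪ boundary G (C (n + 1))
  ne : ∀ n, boundary G (C n) ≠ boundary G (C (n + 1))

namespace IsCutPath

variable {C B C' B' : ℕ → Set V}

/-- As `B n` lies beyond `N(C (n + 1))`, the cut `C (n + 1)` misses `N(C n) ⊆ B n`. A vertex of `N(C
(n + 1))` outside `N(C n)` lies in `C n`; it yields the inclusion through a neighbour and shows that
it is proper. -/
theorem ssubset (h : IsCutPath G C B) (n : ℕ) : C (n + 1) ⊂ C n := by
  obtain ⟨K, hK, hKb, hBK⟩ := (h.block n).exists_side (h.cut (n + 1))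
  have hne : C (n + 1) ≠ K := fun e => h.not_subset n (e ▸ hBK)
  have hdis : Disjoint (C (n + 1)) (boundary G (C n)) :=
    disjoint_of_subset_union (h.cut _).1 hK.1 hKb.symm hne ((h.left n).trans hBK)
  obtain ⟨s, hs, hsn⟩ : ∃ s ∈ boundary G (C (n + 1)), s ∉ boundary G (C n) := by
    by_contra! hcon
    exact h.ne n (boundary_eq_of_subset (h.cut _).1 (h.cut n).1 hcon).symm
  have hsC : s ∈ C n := (h.subset n (h.right n hs)).resolve_right hsn
  obtain ⟨-, w, hw, hsw⟩ := id hs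
  have hwC : w ∈ C n := (mem_or_mem_boundary_of_adj hsC hsw).resolve_right
    (Set.disjoint_left.1 hdis hw)
  refine ⟨connected_subset (cut_connected (h.cut _).1) ⟨w, hw, hwC⟩ hdis, fun hcon => ?_⟩
  exact hs.1 (hcon hsC)

theorem strictAnti (h : IsCutPath G C B) : StrictAnti C := strictAnti_nat_of_succ_lt h.ssubset

theorem boundary_injective (h : IsCutPath G C B) :
    Function.Injective fun n => boundary G (C n) := by
  intro n m hnm
  apply h.strictAnti.injective
  have : (C n ∩ C m).Nonempty := by
    rcases le_total n m with hle | hle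
    · rw [Set.inter_eq_right.2 (h.strictAnti.antitone hle)]; exact cut_nonempty (h.cut m).1
    · rw [Set.inter_eq_left.2 (h.strictAnti.antitone hle)]; exact cut_nonempty (h.cut n).1
  exact cut_eq_of_inter (h.cut n).1 (h.cut m).1 hnm this

theorem block_injective (h : IsCutPath G C B) : Function.Injective B := by
  have key : ∀ n m, n < m → B n ≠ B m := fun n m hnm e => h.not_subset n
    (e ▸ (h.subset m).trans (union_boundary_mono (h.strictAnti.antitone hnm)))
  intro n m hnm
  rcases lt_trichotomy n m with hlt | heq | hlt
  · exact absurd hnm (key _ _ hlt)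
  · exact heq
  · exact absurd hnm.symm (key _ _ hlt)

theorem existsUnique_end (h : IsCutPath G C B) : ∃! ω : VertexEnd G, ∀ n, ω.LiesIn (C n) :=
  existsUnique_end_of_descending (fun n => (h.cut n).1) h.ssubset

theorem eventually_subset (h : IsCutPath G C B) {ω : VertexEnd G} (hω : ∀ n, ω.LiesIn (C n))
    {D : Set V} (hD : D ∈ endCutSystem G) (hωD : ω.LiesIn D) : ∃ m, ∀ n ≥ m, C n ⊆ D := by
  obtain ⟨m, hm⟩ := exists_disjoint_of_descending (fun n => (h.cut n).1) h.ssubset (cut_finite hD)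
  exact ⟨m, fun n hn => cut_subset_of_end (h.cut n).1 (hm n hn) hωD (hω n)⟩

/-- There is no further cut between two consecutive cuts of a ray of the structure tree. -/
theorem eq_of_subset (h : IsCutPath G C B) {ω : VertexEnd G} (hω : ∀ n, ω.LiesIn (C n))
    {D : Set V} (hD : D ∈ nestedSubsystem G) (hωD : ω.LiesIn D) {n : ℕ} (hDC : D ⊆ C n)
    (hDC' : ¬ D ⊆ C (n + 1)) : D = C n := by
  obtain ⟨K, hK, hKb, hBK⟩ := (h.block n).exists_side hD
  by_cases hKD : D = K
  · subst hKD
    have hs : boundary G (C n) ⊆ boundary G D := fun x hx =>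
      (hBK (h.left n hx)).resolve_left fun hxD => hx.1 (hDC hxD)
    exact cut_eq_of_liesIn hD.1 (h.cut n).1 (boundary_eq_of_subset (h.cut n).1 hD.1 hs).symm
      hωD (hω n)
  · exact absurd (cut_subset_of_end hD.1 (disjoint_of_subset_union hD.1 hK.1 hKb.symm hKD
      ((h.right n).trans hBK)) (hω _) hωD) hDC'

/-- Each late cut `C' m` lies in `C N`; the last member of `C` containing it equals it, since a path
skips no cut containing ω. -/
theorem eventually_eq (h : IsCutPath G C B) (h' : IsCutPath G C' B') {ω : VertexEnd G}
    (hω : ∀ n, ω.LiesIn (C n)) (hω' : ∀ n, ω.LiesIn (C' n)) (N : ℕ) :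
    ∃ m₀, ∀ m ≥ m₀, ∃ n ≥ N, C' m = C n := by
  classical
  obtain ⟨m₀, hm₀⟩ := h'.eventually_subset hω' (h.cut N).1 (hω N)
  refine ⟨m₀, fun m hm => ?_⟩
  obtain ⟨x, hx⟩ := cut_nonempty (h'.cut m).1
  have hex : ∃ n, ¬ C' m ⊆ C (N + n + 1) := by
    obtain ⟨n, hn⟩ := exists_notMem_of_descending (fun n => (h.cut n).1) h.ssubset x
    exact ⟨n, fun hs => hn (h.strictAnti.antitone (by omega) (hs hx))⟩
  refine ⟨N + Nat.find hex, by omega, h.eq_of_subset hω (h'.cut m) (hω' m) ?_ (Nat.find_spec hex)⟩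
  rcases Nat.eq_zero_or_eq_succ_pred (Nat.find hex) with h0 | h0
  · rw [h0]; exact hm₀ m hm
  · have := Nat.find_min hex (m := (Nat.find hex).pred) (by omega)
    rw [not_not] at this
    rw [h0]; exact this

end IsCutPath

/-- The ray `ρ` of the structure tree follows the sequences `C`, `B` from its `k`-th vertex on. -/
structure Follows (ρ : Ray (structureTree G (nestedSubsystem G))) (k : ℕ) (C B : ℕ → Set V) :
    Prop where
  path : IsCutPath G C B
  separator : ∀ n, ∃ h, ρ.vert (k + 2 * n) = Sum.inl ⟨boundary G (C n), h⟩
  block : ∀ n, ∃ h, ρ.vert (k + 2 * n + 1) = Sum.inr ⟨B n, h⟩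

theorem structureTree_adj_inl {S : {S : Set V // S ∈ separators G (nestedSubsystem G)}}
    {y : TreeVertex G (nestedSubsystem G)} :
    (structureTree G (nestedSubsystem G)).Adj (Sum.inl S) y ↔
      ∃ B, y = Sum.inr B ∧ S.1 ⊆ B.1 := by
  constructor
  · rintro (⟨S', B, h1, rfl, h⟩ | ⟨S', B, h1, h2, h⟩)
    · cases h1; exact ⟨B, rfl, h⟩
    · cases h2
  · rintro ⟨B, rfl, h⟩
    exact Or.inl ⟨S, B, rfl, rfl, h⟩

theorem structureTree_adj_inr {B : {B : Set V // IsBlock G (nestedSubsystem G) B}}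
    {y : TreeVertex G (nestedSubsystem G)} :
    (structureTree G (nestedSubsystem G)).Adj (Sum.inr B) y ↔
      ∃ S, y = Sum.inl S ∧ S.1 ⊆ B.1 := by
  constructor
  · rintro (⟨S', B, h1, rfl, h⟩ | ⟨S', B, h1, h2, h⟩)
    · cases h1
    · cases h2; exact ⟨S', h1, h⟩
  · rintro ⟨S, rfl, h⟩
    exact Or.inr ⟨S, B, rfl, rfl, h⟩

theorem exists_follows (ρ : Ray (structureTree G (nestedSubsystem G))) :
    ∃ k ≤ 1, ∃ C B, Follows ρ k C B := by
  -- A ray may start in a block, in which case its first vertex is dropped.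
  obtain ⟨k, hk, S₀, hS₀⟩ : ∃ k ≤ 1, ∃ S, ρ.vert k = Sum.inl S := by
    rcases hv : ρ.vert 0 with S | B
    · exact ⟨0, by omega, S, hv⟩
    · obtain ⟨S, hS, -⟩ := structureTree_adj_inr.1 (hv ▸ ρ.adj 0)
      exact ⟨1, le_rfl, S, hS⟩
  have hsep : ∀ n, ∃ S, ρ.vert (k + 2 * n) = Sum.inl S := by
    intro n
    induction n with
    | zero => exact ⟨S₀, hS₀⟩
    | succ n ih =>
      obtain ⟨S, hS⟩ := ih
      obtain ⟨B, hB, -⟩ := structureTree_adj_inl.1 (hS ▸ ρ.adj (k + 2 * n))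
      obtain ⟨S', hS', -⟩ := structureTree_adj_inr.1 (hB ▸ ρ.adj (k + 2 * n + 1))
      exact ⟨S', hS'⟩
  choose S hS using hsep
  have hblock : ∀ n, ∃ B, ρ.vert (k + 2 * n + 1) = Sum.inr B ∧ (S n).1 ⊆ B.1 := fun n =>
    structureTree_adj_inl.1 (hS n ▸ ρ.adj (k + 2 * n))
  choose B hB hSB using hblock
  have hright : ∀ n, (S (n + 1)).1 ⊆ (B n).1 := fun n => by
    obtain ⟨S', hS', h⟩ := structureTree_adj_inr.1 (hB n ▸ ρ.adj (k + 2 * n + 1))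
    have e : S (n + 1) = S' := Sum.inl_injective ((hS (n + 1)).symm.trans hS')
    exact e ▸ h
  have hcut : ∀ n, ∃ C ∈ nestedSubsystem G, boundary G C = (S n).1 ∧
      (B n).1 ⊆ C ∪ boundary G C := fun n => by
    obtain ⟨C, hC, hCS⟩ := (S n).2
    obtain ⟨K, hK, hKb, hBK⟩ := (B n).2.exists_side hC
    exact ⟨K, hK, hKb.trans hCS, hBK⟩
  choose C hC hCS hBC using hcut
  have hSne : ∀ n, S n ≠ S (n + 1) := fun n e => by
    have := ρ.injective (((hS n).trans (congrArg _ e)).trans (hS (n + 1)).symm)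
    omega
  have hBne : ∀ n, B n ≠ B (n + 1) := fun n e => by
    have := ρ.injective (((hB n).trans (congrArg _ e)).trans (hB (n + 1)).symm)
    omega
  refine ⟨k, hk, C, fun n => (B n).1, ⟨hC, fun n => (B n).2, hBC, fun n => hCS n ▸ hSB n,
    fun n => hCS (n + 1) ▸ hright n, fun n h => hBne n (Subtype.ext ?_),
    fun n h => hSne n (Subtype.ext ?_)⟩, fun n => ?_, fun n => ⟨_, hB n⟩⟩
  · exact (B n).2.eq_of_boundary_subset (B (n + 1)).2 (hC (n + 1)) (hCS (n + 1) ▸ hright n)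
      (hCS (n + 1) ▸ hSB (n + 1)) h (hBC (n + 1))
  · rw [← hCS, ← hCS, h]
  · refine ⟨⟨C n, hC n, rfl⟩, ?_⟩
    rw [hS n]; congr 1; exact Subtype.ext (hCS n).symm

section follows

variable {ρ ρ' : Ray (structureTree G (nestedSubsystem G))} {k k' : ℕ} {C B C' B' : ℕ → Set V}

theorem Follows.liesIn (h : Follows ρ k C B) {ω : VertexEnd G}
    (hω : CorrespondsToTreeEnd G (nestedSubsystem G) ω ρ.toEnd) (n : ℕ) : ω.LiesIn (C n) := by
  obtain ⟨h1, hs⟩ := h.separator n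
  obtain ⟨h2, hb⟩ := h.block n
  exact hω ρ rfl _ _ _ hs hb _ (h.path.cut n) rfl (h.path.subset n)

/-- The vertices of the structure tree that lie strictly on the side of the cut `C`. -/
def treeSide (G : SimpleGraph V) (C : Set V) : Set (TreeVertex G (nestedSubsystem G)) :=
  {x | (∃ S, x = Sum.inl S ∧ S.1 ⊆ C ∪ boundary G C ∧ S.1 ≠ boundary G C) ∨
    ∃ B, x = Sum.inr B ∧ B.1 ⊆ C ∪ boundary G C}

/-- The sides of a cut in T are separated by the single vertex `NC`. This is the only separation
property of T needed to compare its rays. -/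
theorem boundary_treeSide_subset {C : Set V} (hC : C ∈ nestedSubsystem G) :
    boundary (structureTree G (nestedSubsystem G)) (treeSide G C) ⊆
      {Sum.inl ⟨boundary G C, C, hC, rfl⟩} := by
  rintro x ⟨hx, y, ⟨S, rfl, hS, hSne⟩ | ⟨B, rfl, hB⟩, hadj⟩
  · obtain ⟨B, rfl, hSB⟩ := structureTree_adj_inl.1 hadj.symm
    exfalso
    obtain ⟨K, hK, hKb, hBK⟩ := B.2.exists_side hC
    have hKC : K ≠ C := fun e => hx (Or.inr ⟨B, rfl, e ▸ hBK⟩)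
    have hsub := subset_boundary_of_subset_of_subset hK.1 hC.1 hKb hKC (hSB.trans hBK) hS
    obtain ⟨D, hD, hDS⟩ := S.2
    exact hSne (by rw [← hDS] at hsub ⊢; exact (boundary_eq_of_subset hD.1 hK.1 hsub).trans hKb)
  · obtain ⟨S, rfl, hSB⟩ := structureTree_adj_inr.1 hadj.symm
    have : S.1 = boundary G C := by
      by_contra hne
      exact hx (Or.inl ⟨S, rfl, hSB.trans hB, hne⟩)
    exact congrArg Sum.inl (Subtype.ext this)

theorem Follows.eventuallyIn_treeSide (h : Follows ρ k C B) (i : ℕ) :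
    ρ.EventuallyIn (treeSide G (C i)) := by
  have hsub : ∀ n ≥ i, B n ⊆ C i ∪ boundary G (C i) := fun n hn =>
    (h.path.subset n).trans (union_boundary_mono (h.path.strictAnti.antitone hn))
  refine ⟨k + 2 * i + 1, fun m hm => ?_⟩
  obtain ⟨n, rfl | rfl⟩ : ∃ n, m = k + 2 * n ∨ m = k + 2 * n + 1 := ⟨(m - k) / 2, by omega⟩
  · obtain ⟨h', e⟩ := h.separator n
    refine Or.inl ⟨_, e, (h.path.left n).trans (hsub n (by omega)), fun e => ?_⟩
    have := h.path.boundary_injective e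
    omega
  · obtain ⟨h', e⟩ := h.block n
    exact Or.inr ⟨_, e, hsub n (by omega)⟩

theorem Follows.corresponds (h : Follows ρ k C B) {ω : VertexEnd G}
    (hω : ∀ n, ω.LiesIn (C n)) :
    CorrespondsToTreeEnd G (nestedSubsystem G) ω ρ.toEnd := by
  intro ρ' hρ' j S Bj hS hBj D hD hDS hBD
  obtain ⟨k', hk', C', B', h'⟩ := exists_follows ρ'
  obtain ⟨i, rfl⟩ : ∃ i, j = k' + 2 * i := by
    by_contra hcon
    push Not at hcon
    obtain ⟨i, rfl | hj⟩ : ∃ i, j = k' + 2 * i + 1 ∨ j + 1 = k' + 2 * i :=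
      ⟨(j + 1 - k') / 2, by have := hcon (j / 2); have := hcon ((j - 1) / 2); omega⟩
    · obtain ⟨_, e⟩ := h'.block i
      rw [hS] at e; cases e
    · obtain ⟨_, e⟩ := h'.separator i
      rw [← hj, hBj] at e; cases e
  have hSi : S.1 = boundary G (C' i) := by
    obtain ⟨_, e⟩ := h'.separator i
    rw [hS] at e; rw [Sum.inl_injective e]
  have hBi : Bj.1 = B' i := by
    obtain ⟨_, e⟩ := h'.block i
    rw [hBj] at e; rw [Sum.inr_injective e]
  obtain rfl : D = C' i := Bj.2.side_unique hD (h'.path.cut i) (hDS.trans hSi) hBD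
    (hBi ▸ h'.path.subset i)
  obtain ⟨L, hL, hLb, hωL⟩ := exists_nested_of_end hD ω
  by_cases hLC : L = C' i
  · exact hLC ▸ hωL
  exfalso
  have hfin := (Set.finite_singleton _).subset (boundary_treeSide_subset hD)
  -- The equivalent ray `ρ'` ends up on this side of one vertex of T, so `ρ` does too. But the cuts
  -- of `ρ` eventually lie in `L`, so a late block of `ρ` would lie on two sides of the same
  -- separator.
  have hρ : ρ.EventuallyIn (treeSide G (C' i)) := by
    refine (ρ.eventuallyIn_or _ hfin).resolve_right fun hst => ?_
    exact Ray.toEnd_eq_iff.1 hρ' (Ray.separated_of_finite_boundary hfin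
      (h'.eventuallyIn_treeSide i) hst)
  obtain ⟨m, hm⟩ := hρ
  obtain ⟨m', hm'⟩ := h.path.eventually_subset hω hL.1 hωL
  have h1 : B (max m m') ⊆ C' i ∪ boundary G (C' i) := by
    obtain ⟨_, e⟩ := h.block (max m m')
    rcases hm (k + 2 * max m m' + 1) (by omega) with ⟨S, e', -⟩ | ⟨B₁, e', hs⟩
    · rw [e] at e'; cases e'
    · rw [e] at e'
      rwa [← Sum.inr_injective e'] at hs
  exact hLC ((h.path.block _).side_unique hL hD hLb
    ((h.path.subset _).trans (union_boundary_mono (hm' _ (le_max_right _ _)))) h1)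

theorem Follows.toEnd_eq (h : Follows ρ k C B) (h' : Follows ρ' k' C' B') {ω : VertexEnd G}
    (hω : ∀ n, ω.LiesIn (C n)) (hω' : ∀ n, ω.LiesIn (C' n)) : ρ.toEnd = ρ'.toEnd := by
  have hcommon : ∀ N, ∃ n ≥ N, ∃ m ≥ N, ρ.vert n = ρ'.vert m := fun N => by
    obtain ⟨m₀, hm₀⟩ := h.path.eventually_eq h'.path hω hω' N
    obtain ⟨n, hn, he⟩ := hm₀ (max m₀ N) (le_max_left _ _)
    refine ⟨k + 2 * n, by omega, k' + 2 * max m₀ N, by omega, ?_⟩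
    obtain ⟨_, e⟩ := h.separator n
    obtain ⟨_, e'⟩ := h'.separator (max m₀ N)
    rw [e, e']
    congr 1
    exact Subtype.ext (by simp only [he])
  rw [Ray.toEnd_eq_iff]
  rintro ⟨A, -, ⟨⟨m, hm⟩, m', hm'⟩ | ⟨⟨m, hm⟩, m', hm'⟩⟩
  · obtain ⟨a, ha, b, hb, e⟩ := hcommon (max m m')
    exact Set.disjoint_left.1 (disjoint_star A) (hm a (by omega)) (e ▸ hm' b (by omega))
  · obtain ⟨a, ha, b, hb, e⟩ := hcommon (max m m')
    exact Set.disjoint_left.1 (disjoint_star A) (hm b (by omega)) (e ▸ hm' a (by omega))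

end follows

theorem existsUnique_correspondsToTreeEnd
    (ε : VertexEnd (structureTree G (nestedSubsystem G))) :
    ∃! ω : VertexEnd G, CorrespondsToTreeEnd G (nestedSubsystem G) ω ε := by
  obtain ⟨ρ, rfl⟩ := ε.exists_ray
  obtain ⟨k, -, C, B, h⟩ := exists_follows ρ
  obtain ⟨ω, hω, huniq⟩ := h.path.existsUnique_end
  exact ⟨ω, h.corresponds hω, fun ω' hω' => huniq ω' (h.liesIn hω')⟩

theorem treeEnd_eq_of_corresponds {ω : VertexEnd G}
    {ε ε' : VertexEnd (structureTree G (nestedSubsystem G))}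
    (h : CorrespondsToTreeEnd G (nestedSubsystem G) ω ε)
    (h' : CorrespondsToTreeEnd G (nestedSubsystem G) ω ε') : ε = ε' := by
  obtain ⟨ρ, rfl⟩ := ε.exists_ray
  obtain ⟨ρ', rfl⟩ := ε'.exists_ray
  obtain ⟨k, -, C, B, hf⟩ := exists_follows ρ
  obtain ⟨k', -, C', B', hf'⟩ := exists_follows ρ'
  exact hf.toEnd_eq hf' (hf.liesIn h) (hf'.liesIn h')

/-! ### Ends and blocks -/

/-- `M` is a smallest optimally nested cut that contains the end `ω`. -/
structure IsMinimalCut (ω : VertexEnd G) (M : Set V) : Prop where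
  mem : M ∈ nestedSubsystem G
  liesIn : ω.LiesIn M
  eq_of_subset : ∀ E ∈ nestedSubsystem G, ω.LiesIn E → E ⊆ M → E = M

variable {ω : VertexEnd G}

theorem IsMinimalCut.boundary_subset {M E : Set V} (h : IsMinimalCut ω M)
    (hE : E ∈ nestedSubsystem G) (hωE : ω.LiesIn E) :
    boundary G M ⊆ E ∪ boundary G E := by
  obtain ⟨L, hL, hLb, hs⟩ := exists_nested_toward hE h.mem
  by_cases hLE : L = E
  · rwa [hLE] at hs
  · have hdis := disjoint_of_subset_union hE.1 hL.1 hLb.symm (Ne.symm hLE) (hLb ▸ hs)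
    rw [h.eq_of_subset E hE hωE (cut_subset_of_end hE.1 hdis h.liesIn hωE)]
    exact Set.subset_union_right

/-- If the cuts containing `ω` satisfy the descending chain condition, then `ω` belongs to a
block. -/
theorem exists_block_of_minimalCut
    (h : ∀ C ∈ nestedSubsystem G, ω.LiesIn C → ∃ M, IsMinimalCut ω M ∧ M ⊆ C) :
    ∃ B, IsBlock G (nestedSubsystem G) B ∧ BelongsToBlock G (nestedSubsystem G) ω B := by
  refine ⟨_, isBlock_of_orientation (P := fun C => ω.LiesIn C)
    (fun C hC => exists_nested_of_end hC ω) rfl fun C hC hB => ?_⟩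
  -- Suppose `B ⊆ NC`. The boundary of each minimal cut lies in `B`, so it equals `NC`; hence there
  -- is only one minimal cut `M`, every cut containing ω contains it, and `M ⊆ B`, contradicting `M
  -- ∩ NC = ∅`.
  have hM : ∀ M, IsMinimalCut ω M → boundary G M = boundary G C := fun M hM =>
    boundary_eq_of_subset hM.mem.1 hC.1 fun _ hv =>
      hB fun E hE hωE => hM.boundary_subset hE hωE hv
  obtain ⟨K, hK, hKb, hωK⟩ := exists_nested_of_end hC ω
  obtain ⟨M, hMin, -⟩ := h K hK hωK
  obtain ⟨v, hv⟩ := cut_nonempty hMin.mem.1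
  have hvC : v ∉ boundary G C := by
    rw [← hM M hMin]; exact Set.disjoint_left.1 (disjoint_boundary M) hv
  refine hvC (hB fun E hE hωE => Or.inl ?_)
  obtain ⟨M', hMin', hM'E⟩ := h E hE hωE
  have : M' = M := cut_eq_of_liesIn hMin'.mem.1 hMin.mem.1
    ((hM M' hMin').trans (hM M hMin).symm) hMin'.liesIn hMin.liesIn
  exact hM'E (this ▸ hv)

theorem block_unique {B B' : Set V} (hB : IsBlock G (nestedSubsystem G) B)
    (hB' : IsBlock G (nestedSubsystem G) B')
    (h : BelongsToBlock G (nestedSubsystem G) ω B)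
    (h' : BelongsToBlock G (nestedSubsystem G) ω B') : B = B' :=
  hB.eq_of_forall hB' fun C hC hs => (h' C hC).1 ((h C hC).2 hs)

/-- Two separators that bound consecutive cuts containing `ω` lie on a common side of each
cut. -/
theorem exists_nested_toward_consecutive {C C' E : Set V} (hC : C ∈ nestedSubsystem G)
    (hC' : C' ∈ nestedSubsystem G) (hs : C' ⊂ C) (hω' : ω.LiesIn C')
    (hcov : ∀ D ∈ nestedSubsystem G, ω.LiesIn D → C' ⊆ D → D ⊆ C → D = C' ∨ D = C)
    (hE : E ∈ nestedSubsystem G) :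
    ∃ K ∈ nestedSubsystem G, boundary G K = boundary G E ∧
      boundary G C ∪ boundary G C' ⊆ K ∪ boundary G K := by
  have hω : ω.LiesIn C := hω'.mono hs.1
  obtain ⟨D, hD, hDb, hDs⟩ := exists_nested_toward hE hC
  obtain ⟨D', hD', hDb', hDs'⟩ := exists_nested_toward hE hC'
  rw [← hDb] at hDs
  rw [← hDb'] at hDs'
  by_cases h1 : boundary G C = boundary G E
  · refine ⟨D', hD', hDb', Set.union_subset ?_ hDs'⟩
    rw [h1, ← hDb']; exact Set.subset_union_right
  by_cases h2 : boundary G C' = boundary G E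
  · refine ⟨D, hD, hDb, Set.union_subset hDs ?_⟩
    rw [h2, ← hDb]; exact Set.subset_union_right
  by_cases hDD : D = D'
  · exact ⟨D, hD, hDb, Set.union_subset hDs (hDD ▸ hDs')⟩
  -- If `NE` strictly separated `NC` from `NC'`, the cut with boundary `NE` containing ω would lie
  -- strictly between `C'` and `C`.
  exfalso
  have hDC' : Disjoint D (boundary G C') :=
    disjoint_of_subset_union hD.1 hD'.1 (hDb.trans hDb'.symm) hDD hDs'
  obtain ⟨s, hsC, hsE⟩ : ∃ s ∈ boundary G C, s ∉ boundary G E := by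
    by_contra! hcon
    exact h1 (boundary_eq_of_subset hC.1 hE.1 hcon)
  have hsD : s ∈ D := (hDs hsC).resolve_right (by rwa [hDb])
  have hdis : Disjoint D C' := by
    by_contra hcon
    have hsub := connected_subset (cut_connected hD.1)
      (Set.not_disjoint_iff_nonempty_inter.1 hcon) hDC'
    exact hsC.1 (hs.1 (hsub hsD))
  have hC'E : Disjoint C' (boundary G E) := by
    rw [Set.disjoint_right, ← hDb]
    rintro u ⟨-, d, hd, hud⟩ huC'
    rcases mem_or_mem_boundary_of_adj huC' hud with h | h
    · exact Set.disjoint_left.1 hdis hd h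
    · exact Set.disjoint_left.1 hDC' hd h
  obtain ⟨L, hL, hLb, hωL⟩ := exists_nested_of_end hE ω
  by_cases hLD : L = D
  · exact (hLD ▸ hωL).not_disjoint hω' hdis
  · have hLC : Disjoint L (boundary G C) :=
      disjoint_of_subset_union hL.1 hD.1 (hLb.trans hDb.symm) hLD hDs
    rcases hcov L hL hωL (cut_subset_of_end hC'.1 (hLb ▸ hC'E) hωL hω')
      (cut_subset_of_end hL.1 hLC hω hωL) with rfl | rfl
    · exact h2 hLb
    · exact h1 hLb

/-- A descending sequence of consecutive cuts containing `ω` is a ray of the structure tree. -/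
theorem exists_isCutPath {C : ℕ → Set V} (hC : ∀ n, C n ∈ nestedSubsystem G)
    (hω : ∀ n, ω.LiesIn (C n)) (hs : ∀ n, C (n + 1) ⊂ C n)
    (hcov : ∀ n, ∀ D ∈ nestedSubsystem G, ω.LiesIn D → C (n + 1) ⊆ D → D ⊆ C n →
      D = C (n + 1) ∨ D = C n) : ∃ B, IsCutPath G C B := by
  let Y : ℕ → Set V := fun n => boundary G (C n) ∪ boundary G (C (n + 1))
  let B : ℕ → Set V := fun n =>
    {v | ∀ D ∈ nestedSubsystem G, Y n ⊆ D ∪ boundary G D → v ∈ D ∪ boundary G D}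
  have hYB : ∀ n, Y n ⊆ B n := fun n v hv D _ hY => hY hv
  have hne : ∀ n, boundary G (C n) ≠ boundary G (C (n + 1)) := fun n e =>
    (hs n).ne (cut_eq_of_liesIn (hC _).1 (hC _).1 e.symm (hω _) (hω _))
  have hblock : ∀ n, IsBlock G (nestedSubsystem G) (B n) ∧ ∀ D ∈ nestedSubsystem G,
      Y n ⊆ D ∪ boundary G D ↔ B n ⊆ D ∪ boundary G D := fun n => by
    refine isBlock_of_orientation (P := fun D => Y n ⊆ D ∪ boundary G D) (fun D hD =>
      exists_nested_toward_consecutive (hC n) (hC (n + 1)) (hs n) (hω _) (hcov n) hD) rfl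
      fun D hD hsub => hne n ?_
    have h := (hYB n).trans hsub
    exact (boundary_eq_of_subset (hC _).1 hD.1 (Set.subset_union_left.trans h)).trans
      (boundary_eq_of_subset (hC _).1 hD.1 (Set.subset_union_right.trans h)).symm
  refine ⟨B, hC, fun n => (hblock n).1, fun n => ?_, fun n => Set.subset_union_left.trans (hYB n),
    fun n => Set.subset_union_right.trans (hYB n), fun n hsub => ?_, hne⟩
  · exact ((hblock n).2 _ (hC n)).1 (Set.union_subset Set.subset_union_right
      (Set.subset_union_right.trans (union_boundary_mono (hs n).1)))
  · refine hne n (boundary_eq_of_subset (hC _).1 (hC _).1 fun x hx => ?_)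
    exact (hsub (hYB n (Or.inl hx))).resolve_left fun h => hx.1 ((hs n).1 h)

theorem IsCutPath.exists_ray {C B : ℕ → Set V} (h : IsCutPath G C B) :
    ∃ ρ : Ray (structureTree G (nestedSubsystem G)), Follows ρ 0 C B := by
  let f : ℕ → TreeVertex G (nestedSubsystem G) := fun n =>
    if n % 2 = 0 then Sum.inl ⟨boundary G (C (n / 2)), _, h.cut (n / 2), rfl⟩
    else Sum.inr ⟨B (n / 2), h.block (n / 2)⟩
  have he : ∀ n, f (2 * n) = Sum.inl ⟨boundary G (C n), _, h.cut n, rfl⟩ := fun n => by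
    have h1 : 2 * n / 2 = n := by omega
    simp only [f, Nat.mul_mod_right, if_true]
    congr 2; rw [h1]
  have ho : ∀ n, f (2 * n + 1) = Sum.inr ⟨B n, h.block n⟩ := fun n => by
    have h1 : (2 * n + 1) / 2 = n := by omega
    have h2 : ¬ (2 * n + 1) % 2 = 0 := by omega
    simp only [f, if_neg h2]
    congr 2; rw [h1]
  refine ⟨⟨f, fun a b hab => ?_, fun n => ?_⟩, h, fun n => ⟨⟨_, h.cut n, rfl⟩, ?_⟩,
    fun n => ⟨h.block n, ?_⟩⟩
  · obtain ⟨a, rfl | rfl⟩ : ∃ k, a = 2 * k ∨ a = 2 * k + 1 := ⟨a / 2, by omega⟩ <;>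
    obtain ⟨b, rfl | rfl⟩ : ∃ k, b = 2 * k ∨ b = 2 * k + 1 := ⟨b / 2, by omega⟩
    · rw [he, he] at hab
      rw [h.boundary_injective (congrArg Subtype.val (Sum.inl_injective hab))]
    · rw [he, ho] at hab; cases hab
    · rw [he, ho] at hab; cases hab
    · rw [ho, ho] at hab
      rw [h.block_injective (congrArg Subtype.val (Sum.inr_injective hab))]
  · obtain ⟨k, rfl | rfl⟩ : ∃ k, n = 2 * k ∨ n = 2 * k + 1 := ⟨n / 2, by omega⟩
    · rw [he, ho]
      exact structureTree_adj_inl.2 ⟨_, rfl, h.left k⟩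
    · rw [ho, show 2 * k + 1 + 1 = 2 * (k + 1) by ring, he]
      exact structureTree_adj_inr.2 ⟨_, rfl, h.right k⟩
  · simpa using he n
  · simpa using ho n

/-- If some cut containing `ω` contains no smallest cut containing `ω`, then `ω` corresponds to an
end of the structure tree. -/
theorem exists_treeEnd_of_no_minimalCut {C₀ : Set V} (hC₀ : C₀ ∈ nestedSubsystem G)
    (hω₀ : ω.LiesIn C₀) (h : ¬ ∃ M, IsMinimalCut ω M ∧ M ⊆ C₀) :
    ∃ ε, CorrespondsToTreeEnd G (nestedSubsystem G) ω ε := by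
  have hstep : ∀ D : {D : Set V // D ∈ nestedSubsystem G ∧ ω.LiesIn D ∧ D ⊆ C₀},
      ∃ D' : {D : Set V // D ∈ nestedSubsystem G ∧ ω.LiesIn D ∧ D ⊆ C₀}, D'.1 ⊂ D.1 ∧
        ∀ E ∈ nestedSubsystem G, ω.LiesIn E → D'.1 ⊆ E → E ⊆ D.1 → E = D'.1 ∨ E = D.1 := by
    rintro ⟨D, hD, hωD, hDC⟩
    obtain ⟨E, hE, hωE, hED, hne⟩ : ∃ E ∈ nestedSubsystem G, ω.LiesIn E ∧ E ⊆ D ∧ E ≠ D := by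
      by_contra! hcon
      exact h ⟨D, ⟨hD, hωD, hcon⟩, hDC⟩
    obtain ⟨x, hx⟩ := cut_nonempty hE.1
    have hfin : {F | F ∈ nestedSubsystem G ∧ ω.LiesIn F ∧ E ⊆ F ∧ F ⊂ D}.Finite :=
      (finite_cuts_between hD.1 x).subset fun F hF => ⟨hF.1.1, hF.2.2.1 hx, hF.2.2.2.1⟩
    -- A maximal cut below `D` exists since only finitely many contain `x`. Consecutive choices are
    -- what makes the sequence a path in T.
    obtain ⟨F, ⟨hF, hωF, hEF, hFD⟩, hmax⟩ :=
      hfin.exists_maximal ⟨E, hE, hωE, subset_rfl, hED.ssubset_of_ne hne⟩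
    refine ⟨⟨F, hF, hωF, hFD.1.trans hDC⟩, hFD, fun E' hE' hωE' h1 h2 => ?_⟩
    by_cases hE'D : E' = D
    · exact Or.inr hE'D
    · exact Or.inl ((hmax ⟨hE', hωE', hEF.trans h1, h2.ssubset_of_ne hE'D⟩ h1).antisymm h1)
  choose step hlt hcov using hstep
  let C : ℕ → {D : Set V // D ∈ nestedSubsystem G ∧ ω.LiesIn D ∧ D ⊆ C₀} :=
    fun n => step^[n] ⟨C₀, hC₀, hω₀, subset_rfl⟩
  have hC : ∀ n, C (n + 1) = step (C n) := fun n => Function.iterate_succ_apply' step n _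
  obtain ⟨B, hB⟩ := exists_isCutPath (ω := ω) (C := fun n => (C n).1) (fun n => (C n).2.1)
    (fun n => (C n).2.2.1) (fun n => by rw [hC]; exact hlt _) (fun n => by rw [hC]; exact hcov _)
  obtain ⟨ρ, hρ⟩ := hB.exists_ray
  exact ⟨ρ.toEnd, hρ.corresponds fun n => (C n).2.2.1⟩

theorem existsUnique_block
    (h : ¬ ∃ ε, CorrespondsToTreeEnd G (nestedSubsystem G) ω ε) :
    ∃! B : Set V, IsBlock G (nestedSubsystem G) B ∧
      BelongsToBlock G (nestedSubsystem G) ω B := by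
  obtain ⟨B, hB, hωB⟩ := exists_block_of_minimalCut (ω := ω) fun C hC hω => by
    by_contra hcon
    exact h (exists_treeEnd_of_no_minimalCut hC hω hcon)
  exact ⟨B, ⟨hB, hωB⟩, fun B' hB' => block_unique hB'.1 hB hB'.2 hωB⟩

/-! ### The trace of an end in a block -/

section trace

variable {B : Set V} {ω : VertexEnd G}

theorem IsBlock.mem_iff (hB : IsBlock G (nestedSubsystem G) B) {v : V} :
    v ∈ B ↔ ∀ D ∈ nestedSubsystem G, B ⊆ D ∪ boundary G D → v ∈ D ∪ boundary G D := by
  refine ⟨fun hv D _ hs => hs hv, fun h => ?_⟩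
  have hins : Inseparable G (nestedSubsystem G) (insert v B) := by
    intro C hC
    rcases hB.maximal.prop C hC with ⟨h1, h2⟩ | ⟨h1, h2⟩
    · exact Or.inl ⟨Set.insert_subset (h C hC h1) h1,
        fun h' => h2 ((Set.subset_insert _ _).trans h')⟩
    · obtain ⟨K, hK, hKb, hBK⟩ := hB.exists_side hC
      have hne : K ≠ C := fun e => h2 (e ▸ hBK)
      refine Or.inr ⟨(Set.insert_subset (h K hK hBK) hBK).trans ?_,
        fun h' => h2 ((Set.subset_insert _ _).trans h')⟩
      rw [hKb]
      exact Set.union_subset_union_left _ (cut_subset_star hK.1 hC.1 hKb hne)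
  exact hB.maximal.eq_of_subset hins (Set.subset_insert _ _) ▸ Set.mem_insert _ _

theorem not_corresponds_of_belongsToBlock (hB : IsBlock G (nestedSubsystem G) B)
    (hω : BelongsToBlock G (nestedSubsystem G) ω B) :
    ¬ ∃ ε, CorrespondsToTreeEnd G (nestedSubsystem G) ω ε := by
  rintro ⟨ε, hε⟩
  obtain ⟨ρ, rfl⟩ := ε.exists_ray
  obtain ⟨k, -, C, B', h⟩ := exists_follows ρ
  have hsub : ∀ n, B ⊆ C n ∪ boundary G (C n) := fun n =>
    (hω _ (h.path.cut n)).1 (h.liesIn hε n)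
  -- The finite set `F` is `B` itself or any κ + 1 of its vertices. The descending cuts eventually
  -- miss `F`, which would then lie in a separator.
  obtain ⟨F, hFB, hF, hFn⟩ : ∃ F ⊆ B, F.Finite ∧ ∀ n, ¬ F ⊆ boundary G (C n) := by
    by_cases hfin : B.Finite
    · exact ⟨B, subset_rfl, hfin, fun n => hB.not_subset_boundary (h.path.cut n)⟩
    · obtain ⟨F, hFB, hF⟩ := Set.Infinite.exists_subset_card_eq hfin
        ((boundary G (C 0)).ncard + 1)
      refine ⟨F, hFB, F.finite_toSet, fun n hn => ?_⟩
      have h1 := Set.ncard_le_ncard hn (cut_finite (h.path.cut n).1)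
      have h2 := ncard_cut_eq (h.path.cut n).1 (h.path.cut 0).1
      rw [Set.ncard_coe_finset] at h1
      omega
  obtain ⟨m, hm⟩ := exists_disjoint_of_descending (fun n => (h.path.cut n).1) h.path.ssubset hF
  exact hFn m fun x hx => (hsub m (hFB hx)).resolve_left
    (Set.disjoint_right.1 (hm m le_rfl) hx)

/-- A vertex outside the block `B` is separated from `B` by a smallest cut containing `ω`, whose
boundary lies in `B`. -/
theorem exists_minimalCut_of_notMem (hB : IsBlock G (nestedSubsystem G) B)
    (hω : BelongsToBlock G (nestedSubsystem G) ω B) {v : V} (hv : v ∉ B) :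
    ∃ M ∈ nestedSubsystem G, B ⊆ M ∪ boundary G M ∧ boundary G M ⊆ B ∧ v ∈ star G M := by
  rw [hB.mem_iff] at hv
  push Not at hv
  obtain ⟨D, hD, hBD, hvD⟩ := hv
  have hωD := (hω D hD).2 hBD
  obtain ⟨M, hM, hMD⟩ : ∃ M, IsMinimalCut ω M ∧ M ⊆ D := by
    by_contra hcon
    exact not_corresponds_of_belongsToBlock hB hω
      (exists_treeEnd_of_no_minimalCut hD hωD hcon)
  exact ⟨M, hM.mem, (hω M hM.mem).1 hM.liesIn, fun x hx => hB.mem_iff.2 fun E hE hBE =>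
    hM.boundary_subset hE ((hω E hE).2 hBE) hx, fun h => hvD (union_boundary_mono hMD h)⟩

theorem IsBlock.exists_disjoint_cut (hB : IsBlock G (nestedSubsystem G) B) {C : Set V}
    (hC : C ∈ nestedSubsystem G) :
    ∃ E ∈ nestedSubsystem G, boundary G E = boundary G C ∧ Disjoint E B := by
  obtain ⟨K, hK, hKb, hBK⟩ := hB.exists_side hC
  obtain ⟨E, hE, hEb, hne⟩ := exists_other_cut hK.1
  exact ⟨E, mem_nestedSubsystem_of_boundary_eq hK hE hEb, hEb.trans hKb,
    disjoint_of_subset_union hE hK.1 hEb hne hBK⟩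

/-- The neighbours of a component of the complement of a block lie in a common separator. -/
theorem exists_separator_of_comp (hB : IsBlock G (nestedSubsystem G) B)
    (hω : BelongsToBlock G (nestedSubsystem G) ω B) {L : Set V} (hL : IsComp G B L) :
    ∃ S ∈ separators G (nestedSubsystem G), boundary G L ⊆ S := by
  obtain ⟨l, hl⟩ := connected_nonempty hL.connected
  obtain ⟨M, hM, hBM, hMB, hlM⟩ := exists_minimalCut_of_notMem hB hω
    (Set.disjoint_left.1 hL.disjoint hl)
  have hLM : L ⊆ star G M := connected_subset hL.connected ⟨l, hl, hlM⟩
    (hL.disjoint.mono_right ((boundary_star_subset M).trans hMB))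
  refine ⟨_, ⟨M, hM, rfl⟩, fun x hx => (hBM (hL.boundary_subset hx)).resolve_left fun hxM => ?_⟩
  obtain ⟨-, w, hw, hxw⟩ := hx
  exact (hLM hw) (mem_or_mem_boundary_of_adj hxM hxw)

theorem Ray.exists_ge_mem_block (hB : IsBlock G (nestedSubsystem G) B)
    (hω : BelongsToBlock G (nestedSubsystem G) ω B) {R : Ray G} (hR : R.toEnd = ω) (N : ℕ) :
    ∃ n ≥ N, R.vert n ∈ B := by
  by_contra! hcon
  obtain ⟨M, hM, hBM, hMB, hv⟩ := exists_minimalCut_of_notMem hB hω (hcon N le_rfl)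
  have key : ∀ n ≥ N, R.vert n ∈ star G M := fun n hn => by
    induction n, hn using Nat.le_induction with
    | base => exact hv
    | succ n hn ih =>
      exact (mem_or_mem_boundary_of_adj ih (R.adj n)).resolve_right
        fun h => hcon (n + 1) (by omega) (hMB (boundary_star_subset M h))
  exact ((hω M hM).2 hBM R hR).elim fun m hm =>
    Set.disjoint_left.1 (disjoint_star M) (hm (max m N) (le_max_left _ _))
      (key _ (le_max_right _ _))

/-- The vertices of `R` in the block `B`, in their order along `R`, are those of the ray `R'` of
the block graph. -/
def IsTrace (R : Ray G) (R' : Ray (blockGraph G (nestedSubsystem G) B)) : Prop :=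
  ∃ φ : ℕ → ℕ, StrictMono φ ∧ Set.range φ = {n | R.vert n ∈ B} ∧
    ∀ n, (R'.vert n : V) = R.vert (φ n)

theorem exists_isTrace (hB : IsBlock G (nestedSubsystem G) B)
    (hω : BelongsToBlock G (nestedSubsystem G) ω B) {R : Ray G} (hR : R.toEnd = ω) :
    ∃ R' : Ray (blockGraph G (nestedSubsystem G) B), IsTrace R R' := by
  have hinf : (Set.ofPred fun n => R.vert n ∈ B).Infinite := by
    rw [Set.infinite_iff_exists_gt]
    intro N
    obtain ⟨n, hn, h⟩ := Ray.exists_ge_mem_block hB hω hR (N + 1)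
    exact ⟨n, h, hn⟩
  set φ := Nat.nth fun n => R.vert n ∈ B with hφ
  have hmono : StrictMono φ := Nat.nth_strictMono hinf
  have hrange : Set.range φ = {n | R.vert n ∈ B} := Nat.range_nth_of_infinite hinf
  have hmem : ∀ n, R.vert (φ n) ∈ B := fun n => hrange.subset ⟨n, rfl⟩
  have hbetween : ∀ n j, φ n < j → j < φ (n + 1) → R.vert j ∉ B := by
    intro n j h1 h2 h
    obtain ⟨i, rfl⟩ := hrange.superset h
    rw [hmono.lt_iff_lt] at h1 h2
    omega
  refine ⟨⟨fun n => ⟨R.vert (φ n), hmem n⟩, fun a b hab => ?_, fun n => ⟨fun e => ?_, ?_⟩⟩,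
    φ, hmono, hrange, fun _ => rfl⟩
  · exact hmono.injective (R.injective (congrArg Subtype.val hab))
  · have := hmono.injective (R.injective (congrArg Subtype.val e))
    omega
  · have hlt : φ n < φ (n + 1) := hmono (Nat.lt_succ_self n)
    rcases Nat.lt_or_ge (φ n + 1) (φ (n + 1)) with h | h
    · right
      -- The excursion between two consecutive visits stays in one component of VX∖B, whose
      -- neighbours share a separator; the visits are joined by an ideal edge.
      obtain ⟨L, hL, hmL⟩ := IsComp.exists_mem (G := G) (hbetween n _ (Nat.lt_succ_self _) h)
      have key : ∀ j ≥ φ n + 1, j < φ (n + 1) → R.vert j ∈ L := fun j hj => by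
        induction j, hj using Nat.le_induction with
        | base => exact fun _ => hmL
        | succ j hj ih =>
          exact fun hlt' => (mem_or_mem_boundary_of_adj (ih (by omega)) (R.adj j)).resolve_right
            fun h' => hbetween n (j + 1) (by omega) hlt' (hL.boundary_subset h')
      obtain ⟨S, hS, hLS⟩ := exists_separator_of_comp hB hω hL
      have hnot : ∀ i, R.vert (φ i) ∉ L := fun i h' =>
        Set.disjoint_left.1 hL.disjoint h' (hmem i)
      refine ⟨S, hS, hLS ⟨hnot n, _, hmL, R.adj _⟩, hLS ⟨hnot (n + 1), _,
        key (φ (n + 1) - 1) (by omega) (by omega), ?_⟩⟩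
      have := R.adj (φ (n + 1) - 1)
      rw [Nat.sub_add_cancel (by omega)] at this
      exact this.symm
    · left
      have e : φ (n + 1) = φ n + 1 := by omega
      change G.Adj (R.vert (φ n)) (R.vert (φ (n + 1)))
      rw [e]; exact R.adj _

theorem IsTrace.eventuallyIn {R : Ray G} {R' : Ray (blockGraph G (nestedSubsystem G) B)}
    (h : IsTrace R R') {Z : Set V} (hZ : R.EventuallyIn Z) :
    R'.EventuallyIn (Subtype.val ⁻¹' Z) := by
  obtain ⟨φ, hφ, -, he⟩ := h
  obtain ⟨m, hm⟩ := hZ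
  refine ⟨m, fun n hn => ?_⟩
  rw [Set.mem_preimage, he]
  exact hm _ (hn.trans (hφ.id_le n))

/-! ### Separation in a block graph -/

/-- A set with boundary in `B` induces a set of the block graph with no larger boundary. -/
theorem boundary_preimage_subset (hB : IsBlock G (nestedSubsystem G) B) {Z : Set V}
    (hZ : boundary G Z ⊆ B) :
    boundary (blockGraph G (nestedSubsystem G) B) (Subtype.val ⁻¹' Z) ⊆
      Subtype.val ⁻¹' boundary G Z := by
  rintro ⟨v, hv⟩ ⟨hvZ, ⟨w, hw⟩, hwZ, -, hadj⟩
  simp only [Set.mem_preimage] at hvZ hwZ hadj ⊢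
  rcases hadj with hadj | ⟨_, ⟨C, hC, rfl⟩, hvC, hwC⟩
  · exact ⟨hvZ, w, hwZ, hadj⟩
  -- An ideal edge leaving `Z` is replaced by a detour through a cut `E` beyond the separator. Since
  -- `E` avoids `B ⊇ NZ`, it lies in `Z` as soon as it meets `Z`, so the far endpoint has a
  -- neighbour in `Z`.
  · obtain ⟨E, hE, hEb, hEB⟩ := hB.exists_disjoint_cut hC
    rw [← hEb] at hvC hwC
    obtain ⟨-, e, he, hwe⟩ := hwC
    obtain ⟨-, e', he', hve'⟩ := hvC
    have heZ : e ∈ Z := (mem_or_mem_boundary_of_adj hwZ hwe).resolve_right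
      fun h => Set.disjoint_left.1 hEB he (hZ h)
    have hEZ := connected_subset (cut_connected hE.1) ⟨e, he, heZ⟩ (hEB.mono_right hZ)
    exact ⟨hvZ, e', hEZ he', hve'⟩

/-- Every set of vertices of the block graph is the trace of a set of vertices with the same
boundary. -/
theorem exists_extension (hB : IsBlock G (nestedSubsystem G) B)
    (hω : BelongsToBlock G (nestedSubsystem G) ω B) (Z' : Set B) :
    ∃ Z : Set V, Subtype.val ⁻¹' Z = Z' ∧ boundary G Z ⊆
      Subtype.val '' boundary (blockGraph G (nestedSubsystem G) B) Z' := by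
  -- Add to `Z'` every component of VX∖B with a neighbour in `Z'`. Its remaining neighbours are
  -- joined to that one by ideal edges, so they are in `Z'` or in its boundary already.
  refine ⟨{v | (∃ h : v ∈ B, ⟨v, h⟩ ∈ Z') ∨ ∃ L, IsComp G B L ∧ v ∈ L ∧
    ∃ h : B, h ∈ Z' ∧ (h : V) ∈ boundary G L}, ?_, ?_⟩
  · ext ⟨v, hv⟩
    constructor
    · rintro (⟨_, h⟩ | ⟨L, hL, hvL, -⟩)
      · exact h
      · exact absurd hv (Set.disjoint_left.1 hL.disjoint hvL)
    · exact fun h => Or.inl ⟨hv, h⟩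
  · rintro v ⟨hv, w, ⟨hwB, hw⟩ | ⟨L, hL, hwL, ⟨z, hzB⟩, hzZ, hzL⟩, hvw⟩
    · by_cases hvB : v ∈ B
      · refine ⟨⟨v, hvB⟩, ⟨fun h => hv (Or.inl ⟨hvB, h⟩), ⟨w, hwB⟩, hw, fun e => ?_, Or.inl hvw⟩,
          rfl⟩
        exact hvw.ne (congrArg Subtype.val e)
      · obtain ⟨L, hL, hvL⟩ := IsComp.exists_mem (G := G) hvB
        exact absurd (Or.inr ⟨L, hL, hvL, ⟨w, hwB⟩, hw,
          fun h => Set.disjoint_left.1 hL.disjoint h hwB, v, hvL, hvw.symm⟩) hv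
    · have hvL : v ∉ L := fun h => hv (Or.inr ⟨L, hL, h, ⟨z, hzB⟩, hzZ, hzL⟩)
      have hvN : v ∈ boundary G L := ⟨hvL, w, hwL, hvw⟩
      have hvB := hL.boundary_subset hvN
      obtain ⟨S, hS, hLS⟩ := exists_separator_of_comp hB hω hL
      have hvZ : (⟨v, hvB⟩ : B) ∉ Z' := fun h => hv (Or.inl ⟨hvB, h⟩)
      exact ⟨⟨v, hvB⟩, ⟨hvZ, ⟨z, hzB⟩, hzZ, fun e => hvZ (e ▸ hzZ),
        Or.inr ⟨S, hS, hLS hvN, hLS hzL⟩⟩, rfl⟩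

/-- A separation of the traces in X_B would extend to a set of finite boundary in X, and ω lies on
only one side of that set. -/
theorem toEnd_trace_eq (hB : IsBlock G (nestedSubsystem G) B)
    (hω : BelongsToBlock G (nestedSubsystem G) ω B) {R₁ R₂ : Ray G} (h₁ : R₁.toEnd = ω)
    (h₂ : R₂.toEnd = ω) {R₁' R₂' : Ray (blockGraph G (nestedSubsystem G) B)}
    (ht₁ : IsTrace R₁ R₁') (ht₂ : IsTrace R₂ R₂') : R₁'.toEnd = R₂'.toEnd := by
  have key : ∀ {R₁ R₂ : Ray G}, R₁.toEnd = ω → R₂.toEnd = ω →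
      ∀ {R₁' R₂' : Ray (blockGraph G (nestedSubsystem G) B)}, IsTrace R₁ R₁' → IsTrace R₂ R₂' →
      ∀ Z', (boundary (blockGraph G (nestedSubsystem G) B) Z').Finite → R₁'.EventuallyIn Z' →
        ¬ R₂'.EventuallyIn (star (blockGraph G (nestedSubsystem G) B) Z') := by
    intro R₁ R₂ h₁ h₂ R₁' R₂' ht₁ ht₂ Z' hZ' hR₁ hR₂
    obtain ⟨Z, rfl, hZ⟩ := exists_extension hB hω Z'
    rcases ω.liesIn_or_star ((hZ'.image _).subset hZ) with h | h
    · exact R₂'.not_eventuallyIn_both _ (ht₂.eventuallyIn (h R₂ h₂)) hR₂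
    · obtain ⟨x, hx, hx'⟩ := (hR₁.inter (ht₁.eventuallyIn (h R₁ h₁))).nonempty
      exact Set.disjoint_left.1 (disjoint_star Z) hx hx'
  rw [Ray.toEnd_eq_iff]
  rintro ⟨Z', hZ', ⟨h, h'⟩ | ⟨h, h'⟩⟩
  · exact key h₁ h₂ ht₁ ht₂ Z' hZ'.2 h h'
  · exact key h₂ h₁ ht₂ ht₁ Z' hZ'.2 h h'

theorem existsUnique_inducesBlockEnd (hB : IsBlock G (nestedSubsystem G) B)
    (hω : BelongsToBlock G (nestedSubsystem G) ω B) :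
    ∃! η : VertexEnd (blockGraph G (nestedSubsystem G) B),
      InducesBlockEnd G (nestedSubsystem G) B ω η := by
  obtain ⟨R, hR⟩ := ω.exists_ray
  obtain ⟨R', hR'⟩ := exists_isTrace hB hω hR
  refine ⟨R'.toEnd, fun R₁ h₁ => ?_, fun η hη => ?_⟩
  · obtain ⟨R₁', h₁'⟩ := exists_isTrace hB hω h₁
    exact ⟨R₁', toEnd_trace_eq hB hω h₁ hR h₁' hR', h₁'⟩
  · obtain ⟨R₁', rfl, h₁'⟩ := hη R hR
    exact toEnd_trace_eq hB hω hR hR h₁' hR'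

theorem liesIn_preimage {η : VertexEnd (blockGraph G (nestedSubsystem G) B)}
    (hη : InducesBlockEnd G (nestedSubsystem G) B ω η) {Z : Set V}
    (hZ : (boundary (blockGraph G (nestedSubsystem G) B) (Subtype.val ⁻¹' Z)).Finite)
    (h : ω.LiesIn Z) : η.LiesIn (Subtype.val ⁻¹' Z) := by
  obtain ⟨R, hR⟩ := ω.exists_ray
  obtain ⟨R', rfl, hR'⟩ := hη R hR
  exact VertexEnd.liesIn_of_ray hZ (IsTrace.eventuallyIn hR' (h R hR))

theorem liesIn_star_preimage {η : VertexEnd (blockGraph G (nestedSubsystem G) B)}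
    (hη : InducesBlockEnd G (nestedSubsystem G) B ω η) {Z : Set V}
    (hZ : (boundary (blockGraph G (nestedSubsystem G) B) (Subtype.val ⁻¹' Z)).Finite)
    (h : ω.LiesIn (star G Z)) :
    η.LiesIn (star (blockGraph G (nestedSubsystem G) B) (Subtype.val ⁻¹' Z)) := by
  refine (η.liesIn_or_star hZ).resolve_left fun h' => ?_
  obtain ⟨R, hR⟩ := ω.exists_ray
  obtain ⟨R', rfl, hR'⟩ := hη R hR
  obtain ⟨x, hx, hx'⟩ := ((h' R' rfl).inter (IsTrace.eventuallyIn hR' (h R hR))).nonempty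
  exact Set.disjoint_left.1 (disjoint_star Z) hx hx'

end trace

/-- In terms of boundaries, separation of ends by at most `k` vertices. -/
theorem separatedByVertices_iff {k : ℕ} {ω₁ ω₂ : VertexEnd G} :
    ω₁.SeparatedByVertices k ω₂ ↔ ∃ Z : Set V, (boundary G Z).Finite ∧
      (boundary G Z).ncard ≤ k ∧ ω₁.LiesIn Z ∧ ω₂.LiesIn (star G Z) := by
  constructor
  · rintro ⟨F, rfl, K₁, K₂, hne, h₁, h₂⟩
    have hK₁ := IsComp.of_componentCompl K₁
    have hK₂ := IsComp.of_componentCompl K₂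
    have hne' : (K₂ : Set V) ≠ K₁ := fun e => hne (SimpleGraph.ComponentCompl.coe_inj.1 e.symm)
    refine ⟨K₁, F.finite_toSet.subset hK₁.boundary_subset, ?_, h₁, h₂.mono
      (hK₂.subset_star hK₁ hne')⟩
    rw [← Set.ncard_coe_finset F]
    exact Set.ncard_le_ncard hK₁.boundary_subset F.finite_toSet
  · rintro ⟨Z, hZ, hk, h₁, h₂⟩
    obtain ⟨R, -⟩ := ω₁.exists_ray
    have : Infinite V := Infinite.of_injective _ R.injective
    rw [Set.ncard_eq_toFinset_card _ hZ] at hk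
    -- The boundary may have fewer than `k` vertices; it is padded to exactly `k`, which is possible
    -- because a ray makes the graph infinite.
    obtain ⟨F, hZF, rfl⟩ := Infinite.exists_superset_card_eq hZ.toFinset k hk
    have hZF : boundary G Z ⊆ F := fun x hx => hZF (hZ.mem_toFinset.2 hx)
    obtain ⟨L₁, hL₁, hω₁⟩ := ω₁.exists_comp F.finite_toSet
    obtain ⟨L₂, hL₂, hω₂⟩ := ω₂.exists_comp F.finite_toSet
    have hs := connected_subset hL₁.connected (hω₁.inter h₁).nonempty
      (hL₁.disjoint.mono_right hZF)
    have hne : L₁ ≠ L₂ := fun e => (hω₂.mono (e ▸ hs)).not_star h₂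
    obtain ⟨K₁, rfl⟩ := hL₁.exists_componentCompl
    obtain ⟨K₂, rfl⟩ := hL₂.exists_componentCompl
    exact ⟨F, rfl, K₁, K₂, fun e => hne (e ▸ rfl), hω₁, hω₂⟩

theorem subset_star_star (A : Set V) : A ⊆ star G (star G A) := fun _ hx =>
  mem_star_iff.2 ⟨fun h => Set.disjoint_left.1 (disjoint_star A) hx h,
    fun h => (boundary_star_subset A h).1 hx⟩

/-- Cutting off the side of a thin separator that is opposite to a cut `M` does not enlarge the
boundary. -/
theorem ncard_boundary_inter_cut_le {M E A : Set V} (hM : M ∈ endCutSystem G)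
    (hE : E ∈ endCutSystem G) (hb : boundary G E = boundary G M) (hne : E ≠ M)
    (hA : (boundary G A).Finite) {α γ : VertexEnd G} (hα : α.LiesIn A)
    (hγ : γ.LiesIn E) (hγA : γ.LiesIn (star G A)) :
    (boundary G (A ∩ M)).ncard ≤ (boundary G A).ncard := by
  have hS := cut_finite hM
  have hAs := VertexEnd.finite_boundary_star hA
  -- The corner `A* ∩ E` separates γ from α, so its boundary has at least κ elements. Submodularity,
  -- `|N(A ∩ M)| + |N(A* ∩ E)| ≤ |NA| + κ`, then gives the claim.
  have h1 := ncard_cut_le hM (finite_boundary_inter hAs (cut_finite hE)) (hγA.inter hγ)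
    (hα.mono ((subset_star_star A).trans (star_anti Set.inter_subset_left)))
  have h2 := ncard_boundary_inter_le hAs (cut_finite hE)
  have h3 := (ncard_add_ncard_add_ncard_le hS (disjoint_star A) (disjoint_boundary A)
    (S := boundary G A) (Set.disjoint_left.2 fun x hx => (mem_star_iff.1 hx).2)).1
  rw [hb] at h2
  have h4 : (E ∩ boundary G (star G A)).ncard ≤ (E ∩ boundary G A).ncard :=
    Set.ncard_le_ncard (Set.inter_subset_inter_right _ (boundary_star_subset A))
      (hA.subset Set.inter_subset_right)
  have h5 : (boundary G (star G A) ∩ boundary G M).ncard ≤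
      (boundary G A ∩ boundary G M).ncard :=
    Set.ncard_le_ncard (Set.inter_subset_inter_left _ (boundary_star_subset A))
      (hA.subset Set.inter_subset_left)
  have h6 : (boundary G (A ∩ M)).ncard ≤
      (A ∩ boundary G M).ncard + (boundary G A \ E).ncard := by
    refine (Set.ncard_le_ncard ?_ ((hS.subset Set.inter_subset_right).union hA.sdiff)).trans
      (Set.ncard_union_le _ _)
    refine (boundary_inter_subset A M).trans ?_
    rintro x ((hx | hx) | hx)
    · exact Or.inl hx
    · exact Or.inr ⟨hx.2, Set.disjoint_right.1 (cut_disjoint hE hM hb hne) hx.1⟩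
    · exact Or.inr ⟨hx.1, fun h => Set.disjoint_left.1 (disjoint_boundary E) h (hb ▸ hx.2)⟩
  have h7 := Set.ncard_inter_add_ncard_sdiff_eq_ncard (boundary G A) E hA
  rw [Set.inter_comm] at h7
  omega

/-- Two ends that belong to `B` and are separated by `k` vertices are separated by at most `k`
vertices of `B`. -/
theorem exists_separating_in_block {B : Set V} {ω₁ ω₂ : VertexEnd G}
    (hB : IsBlock G (nestedSubsystem G) B)
    (h₁ : BelongsToBlock G (nestedSubsystem G) ω₁ B)
    (h₂ : BelongsToBlock G (nestedSubsystem G) ω₂ B) {Z : Set V} (hZ : (boundary G Z).Finite)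
    (hω₁ : ω₁.LiesIn Z) (hω₂ : ω₂.LiesIn (star G Z)) :
    ∃ Y : Set V, (boundary G Y).Finite ∧ (boundary G Y).ncard ≤ (boundary G Z).ncard ∧
      ω₁.LiesIn Y ∧ ω₂.LiesIn (star G Y) ∧ boundary G Y ⊆ B := by
  induction hn : (boundary G Z \ B).ncard using Nat.strong_induction_on generalizing Z with
  | _ n ih =>
  subst hn
  by_cases hZB : boundary G Z ⊆ B
  · exact ⟨Z, hZ, le_rfl, hω₁, hω₂, hZB⟩
  obtain ⟨v, hv, hvB⟩ := Set.not_subset.1 hZB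
  obtain ⟨M, hM, hBM, hMB, hvM⟩ := exists_minimalCut_of_notMem hB h₁ hvB
  obtain ⟨E, hE, hEb, hne⟩ := exists_other_cut hM.1
  obtain ⟨γ, -, hγ, -⟩ := cut_exists_ends hE
  have hM₁ := (h₁ M hM).2 hBM
  have hM₂ := (h₂ M hM).2 hBM
  -- Intersecting with `M` drops `v`, and any new boundary vertices belong to `NM ⊆ B`; so fewer
  -- boundary vertices lie outside `B`.
  have hdec : ∀ A, boundary G A ⊆ boundary G Z →
      (boundary G (A ∩ M) \ B).ncard < (boundary G Z \ B).ncard := fun A hA => by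
    refine Set.ncard_lt_ncard ⟨?_, fun h => ?_⟩ hZ.sdiff
    · rintro x ⟨hx, hxB⟩
      refine ⟨?_, hxB⟩
      rcases boundary_inter_subset A M hx with (hx | hx) | hx
      exacts [absurd (hMB hx.2) hxB, hA hx.2, hA hx.1]
    · rcases boundary_inter_subset A M (h ⟨hv, hvB⟩).1 with (hx | hx) | hx
      exacts [hvB (hMB hx.2), (mem_star_iff.1 hvM).1 hx.1, hvB (hMB hx.2)]
  -- The uncrossing needs γ opposite to the side being cut down: `Z` is replaced by `Z ∩ M` if γ
  -- lies in `Z*`, and by `(Z* ∩ M)*` otherwise.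
  rcases γ.liesIn_or_star hZ with hγZ | hγZ
  · have hZs := VertexEnd.finite_boundary_star hZ
    have hle := ncard_boundary_inter_cut_le hM.1 hE hEb hne hZs hω₂ hγ
      (hγZ.mono (subset_star_star Z))
    have hfin := finite_boundary_inter hZs (cut_finite hM.1)
    have hb := boundary_star_subset (G := G) (star G Z ∩ M)
    obtain ⟨Y, hY, hYle, hY₁, hY₂, hYB⟩ := ih _ ((Set.ncard_le_ncard
      (Set.sdiff_subset_sdiff_left hb) hfin.sdiff).trans_lt (hdec _ (boundary_star_subset Z)))
      (VertexEnd.finite_boundary_star hfin)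
      (hω₁.mono ((subset_star_star Z).trans (star_anti Set.inter_subset_left)))
      ((hω₂.inter hM₂).mono (subset_star_star _)) rfl
    exact ⟨Y, hY, hYle.trans ((Set.ncard_le_ncard hb hfin).trans (hle.trans
      (Set.ncard_le_ncard (boundary_star_subset Z) hZ))), hY₁, hY₂, hYB⟩
  · have hle := ncard_boundary_inter_cut_le hM.1 hE hEb hne hZ hω₁ hγ hγZ
    obtain ⟨Y, hY, hYle, hY₁, hY₂, hYB⟩ := ih _ (hdec Z subset_rfl)
      (finite_boundary_inter hZ (cut_finite hM.1)) (hω₁.inter hM₁)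
      (hω₂.mono (star_anti Set.inter_subset_left)) rfl
    exact ⟨Y, hY, hYle.trans hle, hY₁, hY₂, hYB⟩

theorem separatedByVertices_blockGraph_iff {B : Set V} {ω₁ ω₂ : VertexEnd G}
    (hB : IsBlock G (nestedSubsystem G) B)
    (h₁ : BelongsToBlock G (nestedSubsystem G) ω₁ B)
    (h₂ : BelongsToBlock G (nestedSubsystem G) ω₂ B)
    {η₁ η₂ : VertexEnd (blockGraph G (nestedSubsystem G) B)}
    (hη₁ : InducesBlockEnd G (nestedSubsystem G) B ω₁ η₁)
    (hη₂ : InducesBlockEnd G (nestedSubsystem G) B ω₂ η₂) (k : ℕ) :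
    ω₁.SeparatedByVertices k ω₂ ↔ η₁.SeparatedByVertices k η₂ := by
  rw [separatedByVertices_iff, separatedByVertices_iff]
  constructor
  · rintro ⟨Z, hZ, hk, hω₁, hω₂⟩
    obtain ⟨Y, hY, hle, hY₁, hY₂, hYB⟩ := exists_separating_in_block hB h₁ h₂ hZ hω₁ hω₂
    have hsub := boundary_preimage_subset hB hYB
    have hpre := hY.preimage (f := (Subtype.val : B → V)) Subtype.val_injective.injOn
    have hfin := hpre.subset hsub
    refine ⟨_, hfin, ?_, liesIn_preimage hη₁ hfin hY₁, liesIn_star_preimage hη₂ hfin hY₂⟩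
    refine (Set.ncard_le_ncard hsub hpre).trans (le_trans ?_ (hle.trans hk))
    rw [← Set.ncard_image_of_injective _ Subtype.val_injective]
    exact Set.ncard_le_ncard (Set.image_preimage_subset _ _) hY
  · rintro ⟨Z', hZ', hk, hη₁', hη₂'⟩
    obtain ⟨Z, rfl, hZ⟩ := exists_extension hB h₁ Z'
    have hfin := (hZ'.image _).subset hZ
    refine ⟨Z, hfin, ?_, ?_, ?_⟩
    · refine (Set.ncard_le_ncard hZ (hZ'.image _)).trans ?_
      rwa [Set.ncard_image_of_injective _ Subtype.val_injective]
    · exact (ω₁.liesIn_or_star hfin).resolve_right fun h =>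
        hη₁'.not_star (liesIn_star_preimage hη₁ hZ' h)
    · exact (ω₂.liesIn_or_star hfin).resolve_left fun h =>
        (liesIn_preimage hη₂ hZ' h).not_star hη₂'

end StructureTree

/-! ### Assembly of the theorem -/

theorem theorem8p10 {V : Type*} (G : SimpleGraph V) (hG : G.Connected) :
    -- every end of the structure tree corresponds to exactly one end of the graph
    (∀ ε : StructureTree.VertexEnd
          (StructureTree.structureTree G (StructureTree.nestedSubsystem G)),
        ∃! ω : StructureTree.VertexEnd G,
          StructureTree.CorrespondsToTreeEnd G (StructureTree.nestedSubsystem G) ω ε) ∧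
    -- distinct ends of the structure tree correspond to distinct ends of the graph
    (∀ (ω : StructureTree.VertexEnd G)
        (ε ε' : StructureTree.VertexEnd
          (StructureTree.structureTree G (StructureTree.nestedSubsystem G))),
        StructureTree.CorrespondsToTreeEnd G (StructureTree.nestedSubsystem G) ω ε →
        StructureTree.CorrespondsToTreeEnd G (StructureTree.nestedSubsystem G) ω ε' → ε = ε') ∧
    -- every other end of the graph belongs to a unique block
    (∀ ω : StructureTree.VertexEnd G,
        (¬ ∃ ε, StructureTree.CorrespondsToTreeEnd G (StructureTree.nestedSubsystem G) ω ε) →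
        ∃! B : Set V, StructureTree.IsBlock G (StructureTree.nestedSubsystem G) B ∧
          StructureTree.BelongsToBlock G (StructureTree.nestedSubsystem G) ω B) ∧
    ∀ B : Set V, StructureTree.IsBlock G (StructureTree.nestedSubsystem G) B →
      -- an end that belongs to `B` determines an end of `X_B`
      (∀ ω : StructureTree.VertexEnd G,
        StructureTree.BelongsToBlock G (StructureTree.nestedSubsystem G) ω B →
        ∃! η : StructureTree.VertexEnd
            (StructureTree.blockGraph G (StructureTree.nestedSubsystem G) B),
          StructureTree.InducesBlockEnd G (StructureTree.nestedSubsystem G) B ω η) ∧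
      -- separation by `k` vertices is the same in `X` and in `X_B`
      ∀ ω₁ ω₂ : StructureTree.VertexEnd G,
        StructureTree.BelongsToBlock G (StructureTree.nestedSubsystem G) ω₁ B →
        StructureTree.BelongsToBlock G (StructureTree.nestedSubsystem G) ω₂ B →
        ∀ η₁ η₂ : StructureTree.VertexEnd
            (StructureTree.blockGraph G (StructureTree.nestedSubsystem G) B),
          StructureTree.InducesBlockEnd G (StructureTree.nestedSubsystem G) B ω₁ η₁ →
          StructureTree.InducesBlockEnd G (StructureTree.nestedSubsystem G) B ω₂ η₂ →
          ∀ k : ℕ, ω₁.SeparatedByVertices k ω₂ ↔ η₁.SeparatedByVertices k η₂ := by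
  open StructureTree in
  exact ⟨existsUnique_correspondsToTreeEnd, fun _ _ _ h h' => treeEnd_eq_of_corresponds h h',
    fun _ h => existsUnique_block h, fun B hB => ⟨fun _ hω => existsUnique_inducesBlockEnd hB hω,
      fun _ _ h₁ h₂ _ _ hη₁ hη₂ k => separatedByVertices_blockGraph_iff hB h₁ h₂ hη₁ hη₂ k⟩⟩
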